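/- Let $\mathbb T=\mathbb R/\mathbb Z$ with projection $\pi:\mathbb R\to\mathbb T$; clockwise means increasing. Let $F:\mathbb T\to\mathbb R$ be continuous (also regarded as a $1$-periodic function on $\mathbb R$), and suppose that $\{F=0\}$ has finitely many connected components. Write $F_+=F\vee 0$, $F_-=|F\wedge 0|$ and $S(x)=\int_0^xF(s)\,ds$ for $x\in\mathbb R$. For $x,y\in\mathbb T$ let $\gamma^+_{x,y}$ be the clockwise path from $x$ to $y$ and $\gamma^-_{x,y}=\gamma^+_{y,x}$ the (unoriented) anticlockwise one, with $\gamma^\pm_{x,x}=\{x\}$. Set $$\Delta S(x,y)=\int_{\gamma^+_{x,y}}F,\quad V_\pm(x,y)=\int_{\gamma^\pm_{x,y}}F_\pm,\quad V(x,y)=V_+(x,y)\wedge V_-(x,y).$$ For $f\in\{V,V_+,V_-\}$, components $C,D$ of $\{F=0\}$ and $y\in\mathbb T$, let $f(C,D)=0$ if $C=D$ and otherwise $f(C,D)=f(c,d)$ for any $c\in C,d\in D$; let $f(C,y)=0$ if $y\in C$ and otherwise $f(C,y)=f(c,y)$ for any $c\in C$. For $C\ne D$ put $\Delta S(C,D)=\Delta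 S(c,d)$. (These do not depend on the choice of points.) A component $\pi([a,b])$ of $\{F=0\}$ is stable if for some $\varepsilon>0$ one has $F<0$ on $[a-\varepsilon,a)$ and $F>0$ on $(b,b+\varepsilon]$, and totally unstable if $F>0$ on $[a-\varepsilon,a)$ and $F<0$ on $(b,b+\varepsilon]$. Let $K_1,\dots,K_\ell$ be the stable components, labelled clockwise with labels modulo $\ell$; assume $\ell\ge1$. For sets $A,B$ write $A\le x\le B$ if $x\in\gamma^+_{a,b}$ for some $a\in A,b\in B$; a strict sign on one side means that in addition $x$ is not in that set. If $\ell=1$, then $K_i<x<K_{i+1}$ means $x\notin K_1$. Let $A_i$ be the unique totally unstable component between $K_i$ and $K_{i+1}$. Let $G\{i\}$ be the set of directed trees on the vertices $1,\dots,\ell$ rooted at $i$ and pointing towards the root, and define $$W(K_i)=\min_{g\in G\{i\}}\sum_{(m\to n)\in g}V(K_m,K_n),\qquad W(x)=\min_{1\le i\le\ell}\bigl[W(K_i)+V(K_i,x)\bigr]$$ (so $W(K_1)=0$ if $\ell=1$). For labels $i$ and $j\in\{i,\dots,i+\ell-1\}$, read modulo $\ell$, let $g_{i,j}$ be the graph with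 anticlockwise arrows $r\to r-1$ for $i<r\le j$ and clockwise arrows $r\to r+1$ for $j<r<i+\ell$. **(i)** Let $\ell\ge2$ and fix $i$. There is a $J$ such that $$\Delta S(K_i,A_J)=\max_{y\in[\bar x,\bar x+1]}\bigl(S(y)-S(\bar x)\bigr)\quad\text{for all }\bar x\in\mathbb R\text{ with }\pi(\bar x)\in K_i.$$ If $J$ satisfies this identity for some such $\bar x$, then it does for all such $\bar x$; moreover $g_{i,J}\in G\{i\}$, $$W(K_i)=\sum_{(m\to n)\in g_{i,J}}V(K_m,K_n),$$ and $V(K_m,K_{m-1})=V_-(K_m,K_{m-1})$ for each anticlockwise arrow $m\to m-1$ of $g_{i,J}$, while $V(K_m,K_{m+1})=V_+(K_m,K_{m+1})$ for each clockwise arrow $m\to m+1$ of $g_{i,J}$. **(ii)** Let $\ell\ge1$ and $x\in\mathbb T\setminus\bigcup_rK_r$. There is an $i$ with $K_i<x<K_{i+1}$. For any such $i$, take $x_i\in K_i$ and $x_{i+1}\in K_{i+1}$ (with $x_{i+1}=x_i$ if $\ell=1$), a lift $\bar x_i\in\mathbb R$ of $x_i$, and lifts $\bar x,\bar x_{i+1}\in(\bar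 x_i,\bar x_i+1]$ of $x,x_{i+1}$. Write $M(u)=\max_{y\in[u,u+1]}S(y)$ and consider the cases 1. $x_i<x\le A_i$ and $M(\bar x_i)=M(\bar x)$; 2. $x_i<x\le A_i$ and $M(\bar x_i)<M(\bar x)$; 3. $A_i\le x<x_{i+1}$ and $M(\bar x_{i+1})=M(\bar x)$; 4. $A_i\le x<x_{i+1}$ and $M(\bar x_{i+1})<M(\bar x)$. If $x\notin A_i$, exactly one of the four cases holds; if $x\in A_i$, exactly one of (1), (2) and exactly one of (3), (4) holds. Whenever (1) or (4) holds, $$W(x)=W(K_i)+V(K_i,x),\qquad V(K_i,x)=V_+(K_i,x),$$ and whenever (2) or (3) holds, $$W(x)=W(K_{i+1})+V(K_{i+1},x),\qquad V(K_{i+1},x)=V_-(K_{i+1},x).$$ -/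

import Mathlib

open Set

noncomputable section

namespace FW

/-- The one-dimensional torus `ℝ / ℤ`; `(s : Torus)` is the canonical projection of `s : ℝ`, and
clockwise means in the direction of increasing `s`. -/
abbrev Torus : Type := UnitAddCircle

/-- The length in `[0, 1)` of the clockwise path from `x` to `y`. -/
def cwDist (x y : Torus) : ℝ := (AddCircle.equivIco (1 : ℝ) 0 (y - x) : ℝ)

/-- The clockwise path `γ⁺` from `x` to `y` (equal to `{x}` if `x = y`).
The anticlockwise path from `x` to `y` is `cwArc y x`. -/
def cwArc (x y : Torus) : Set Torus := (fun t : ℝ => x + (t : Torus)) '' Icc 0 (cwDist x y)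

/-- The integral of `h` over the (unoriented) path `cwArc x y`. -/
def cwIntegral (h : Torus → ℝ) (x y : Torus) : ℝ :=
  ∫ t in (0 : ℝ)..cwDist x y, h (x + (t : Torus))

/-- `S(x) = ∫₀ˣ F(s) ds`. -/
def S (F : Torus → ℝ) (x : ℝ) : ℝ := ∫ s in (0 : ℝ)..x, F (s : Torus)

/-- `max_{y ∈ [u, u+1]} S(y)`. -/
def windowMax (F : Torus → ℝ) (u : ℝ) : ℝ := sSup (S F '' Icc u (u + 1))

/-- `max_{y ∈ [u, u+1]} (S(y) - S(u))`. -/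
def windowRise (F : Torus → ℝ) (u : ℝ) : ℝ := sSup ((fun y => S F y - S F u) '' Icc u (u + 1))

/-- `ΔS(x, y)`, the integral of `F` along the clockwise path from `x` to `y`. -/
def deltaS (F : Torus → ℝ) (x y : Torus) : ℝ := cwIntegral F x y

/-- `V₊(x, y)`, the integral of `F₊` along the clockwise path from `x` to `y`. -/
def Vplus (F : Torus → ℝ) (x y : Torus) : ℝ := cwIntegral (fun s => max (F s) 0) x y

/-- `V₋(x, y)`, the integral of `F₋` along the anticlockwise path from `x` to `y`. -/
def Vminus (F : Torus → ℝ) (x y : Torus) : ℝ := cwIntegral (fun s => |min (F s) 0|) y x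

/-- `V(x, y) = V₊(x, y) ∧ V₋(x, y)`. -/
def V (F : Torus → ℝ) (x y : Torus) : ℝ := min (Vplus F x y) (Vminus F x y)

/-- `C` is a connected component of `{x | F x = 0}`. -/
def IsZeroComponent (F : Torus → ℝ) (C : Set Torus) : Prop :=
  ∃ x, F x = 0 ∧ C = connectedComponentIn {y | F y = 0} x

/-- `C` is a stable connected component of `{F = 0}`: it is the projection of some `[a, b]` with
`F < 0` immediately before `a` and `F > 0` immediately after `b`. -/
def IsStable (F : Torus → ℝ) (C : Set Torus) : Prop :=
  IsZeroComponent F C ∧ ∃ a b : ℝ, a ≤ b ∧ C = (fun s : ℝ => (s : Torus)) '' Icc a b ∧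
    ∃ ε > 0, (∀ s ∈ Ico (a - ε) a, F (s : Torus) < 0) ∧ (∀ s ∈ Ioc b (b + ε), 0 < F (s : Torus))

/-- `C` is a totally unstable connected component of `{F = 0}`. -/
def IsTotallyUnstable (F : Torus → ℝ) (C : Set Torus) : Prop :=
  IsZeroComponent F C ∧ ∃ a b : ℝ, a ≤ b ∧ C = (fun s : ℝ => (s : Torus)) '' Icc a b ∧
    ∃ ε > 0, (∀ s ∈ Ico (a - ε) a, 0 < F (s : Torus)) ∧ (∀ s ∈ Ioc b (b + ε), F (s : Torus) < 0)

/-- `A ≤ x ≤ B`: `x` is on the clockwise path from some point of `A` to some point of `B`. -/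
def LeLe (A : Set Torus) (x : Torus) (B : Set Torus) : Prop :=
  ∃ a ∈ A, ∃ b ∈ B, x ∈ cwArc a b

/-- `A < x < B`. If `A = B`, the clockwise path from `A` back to itself is meant, so that the
points strictly between are those outside `A`. -/
def Between (A : Set Torus) (x : Torus) (B : Set Torus) : Prop :=
  x ∉ A ∧ x ∉ B ∧ (A = B ∨ LeLe A x B)

/-- `K` lists every stable component of `{F = 0}` exactly once, in clockwise cyclic order: between
`K i` and `K (i + 1)` there is no stable component. Labels are read modulo `ℓ`. -/
def IsLabelling (F : Torus → ℝ) {ℓ : ℕ} (K : ZMod ℓ → Set Torus) : Prop :=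
  BijOn K univ {C | IsStable F C} ∧
    ∀ i j : ZMod ℓ, ∀ x ∈ K j, ¬ Between (K i) x (K (i + 1))

/-- `A i`: the totally unstable component between `K i` and `K (i + 1)` (there is exactly one). -/
def unstableBetween (F : Torus → ℝ) {ℓ : ℕ} (K : ZMod ℓ → Set Torus) (i : ZMod ℓ) : Set Torus :=
  ⋃₀ {C | IsTotallyUnstable F C ∧ ∀ x ∈ C, Between (K i) x (K (i + 1))}

/-- A point of the set `C`. -/
def pt (C : Set Torus) : Torus := Classical.epsilon fun x => x ∈ C

/-- `f(C, D)`, for `f` one of `V`, `V₊`, `V₋` and components `C`, `D` of `{F = 0}`: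
zero if `C = D`, otherwise the value `f(x, y)`, the same for all `x ∈ C` and `y ∈ D`. -/
def setSet (f : Torus → Torus → ℝ) (C D : Set Torus) : ℝ :=
  open Classical in if C = D then 0 else f (pt C) (pt D)

/-- `f(C, y)`, for `f` one of `V`, `V₊`, `V₋`, a component `C` of `{F = 0}` and a point `y`:
zero if `y ∈ C`, otherwise the value `f(x, y)`, the same for all `x ∈ C`. -/
def setPoint (f : Torus → Torus → ℝ) (C : Set Torus) (y : Torus) : ℝ :=
  open Classical in if y ∈ C then 0 else f (pt C) y

/-- The family `G{i}`: directed trees (given by their sets of arrows) on all labels, rooted at `i`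
and pointing towards the root. -/
def rootedTrees {ℓ : ℕ} (i : ZMod ℓ) : Set (Finset (ZMod ℓ × ZMod ℓ)) :=
  {g | (∀ j, j ≠ i → ∃! n, (j, n) ∈ g) ∧
    (∀ j, j ≠ i → Relation.TransGen (fun m n => (m, n) ∈ g) j i) ∧
    ∀ n, (i, n) ∉ g}

theorem rootedTrees_nonempty {ℓ : ℕ} [NeZero ℓ] (i : ZMod ℓ) : (rootedTrees i).Nonempty := by
  refine ⟨(Finset.univ.filter fun j => j ≠ i).image fun j => (j, i), ?_, ?_, ?_⟩
  · intro j hj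
    refine ⟨i, by simp [hj], ?_⟩
    intro n hn
    simp at hn
    exact hn.2.symm
  · intro j hj
    exact Relation.TransGen.single (by simp [hj])
  · intro n hn
    simp at hn

/-- The total cost `∑ V(K_m, K_n)` over the arrows `m → n` of `g`. -/
def cost (F : Torus → ℝ) {ℓ : ℕ} (K : ZMod ℓ → Set Torus) (g : Finset (ZMod ℓ × ZMod ℓ)) : ℝ :=
  ∑ p ∈ g, setSet (V F) (K p.1) (K p.2)

/-- `W(K_i)`, the minimum of the cost over `G{i}`. If `ℓ = 1`, the only graph has no arrow and
`W(K_i) = 0`. -/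
def WK (F : Torus → ℝ) {ℓ : ℕ} [NeZero ℓ] (K : ZMod ℓ → Set Torus) (i : ZMod ℓ) : ℝ :=
  (Set.toFinite (rootedTrees i)).toFinset.inf'
    ((Set.Finite.toFinset_nonempty _).2 (rootedTrees_nonempty i)) (cost F K)

/-- `W(x) = min_i (W(K_i) + V(K_i, x))`, for `ℓ ≥ 1` stable components. -/
def W (F : Torus → ℝ) {ℓ : ℕ} [NeZero ℓ] (K : ZMod ℓ → Set Torus) (x : Torus) : ℝ :=
  (Finset.univ : Finset (ZMod ℓ)).inf' Finset.univ_nonempty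
    fun i => WK F K i + setPoint (V F) (K i) x

/-- The labels `i + 1, …, j`, from which the anticlockwise arrows of `g_{i,j}` start. -/
def acwStarts {ℓ : ℕ} [NeZero ℓ] (i j : ZMod ℓ) : Finset (ZMod ℓ) :=
  Finset.univ.filter fun m => 0 < (m - i).val ∧ (m - i).val ≤ (j - i).val

/-- The labels `j + 1, …, i + ℓ - 1`, from which the clockwise arrows of `g_{i,j}` start. -/
def cwStarts {ℓ : ℕ} [NeZero ℓ] (i j : ZMod ℓ) : Finset (ZMod ℓ) :=
  Finset.univ.filter fun m => (j - i).val < (m - i).val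

/-- The graph `g_{i,j}`, with anticlockwise arrows `j → j - 1 → ⋯ → i` and clockwise arrows
`j + 1 → j + 2 → ⋯ → i + ℓ`. -/
def specialGraph {ℓ : ℕ} [NeZero ℓ] (i j : ZMod ℓ) : Finset (ZMod ℓ × ZMod ℓ) :=
  (acwStarts i j).image (fun m => (m, m - 1)) ∪ (cwStarts i j).image (fun m => (m, m + 1))

/-- `ΔS(K_i, A_J) = max_{y ∈ [u, u+1]} (S(y) - S(u))`. -/
def Realizes (F : Torus → ℝ) {ℓ : ℕ} (K : ZMod ℓ → Set Torus) (i J : ZMod ℓ) (u : ℝ) : Prop :=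
  deltaS F (pt (K i)) (pt (unstableBetween F K J)) = windowRise F u

/-- With `A = A_i` and with `u`, `v`, `w` lifting `x_i`, `x`, `x_{i+1}`: case (1),
`x_i < x ≤ A` and `max_{[u, u+1]} S = max_{[v, v+1]} S`. -/
def Case1 (F : Torus → ℝ) (A : Set Torus) (u v : ℝ) : Prop :=
  ((v : Torus) ≠ (u : Torus) ∧ LeLe {(u : Torus)} (v : Torus) A) ∧ windowMax F u = windowMax F v

/-- Case (2): `x_i < x ≤ A` and `max_{[u, u+1]} S < max_{[v, v+1]} S`. -/
def Case2 (F : Torus → ℝ) (A : Set Torus) (u v : ℝ) : Prop :=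
  ((v : Torus) ≠ (u : Torus) ∧ LeLe {(u : Torus)} (v : Torus) A) ∧ windowMax F u < windowMax F v

/-- Case (3): `A ≤ x < x_{i+1}` and `max_{[w, w+1]} S = max_{[v, v+1]} S`. -/
def Case3 (F : Torus → ℝ) (A : Set Torus) (v w : ℝ) : Prop :=
  ((v : Torus) ≠ (w : Torus) ∧ LeLe A (v : Torus) {(w : Torus)}) ∧ windowMax F w = windowMax F v

/-- Case (4): `A ≤ x < x_{i+1}` and `max_{[w, w+1]} S < max_{[v, v+1]} S`. -/
def Case4 (F : Torus → ℝ) (A : Set Torus) (v w : ℝ) : Prop :=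
  ((v : Torus) ≠ (w : Torus) ∧ LeLe A (v : Torus) {(w : Torus)}) ∧ windowMax F w < windowMax F v

end FW

end

namespace FW

/-! Let P be the integral of F₊ over one period and R(u) the largest rise of S from u over one turn
(`windowRise`). Everything rests on two formulas: W(K_i) = P − R(K_i), and W(x) = P − R(x) for x
outside the stable components.

For the first, cut the circle at K_i. In each of the ℓ gaps between consecutive stable components S
rises to a peak, lying in the totally unstable component, and then falls (`IsLabelling.exists_gap`),
so R(K_i) is reached at a peak. An arrow of a tree costs at least the F₊-mass of the gaps it crosses
clockwise, or the F₋-mass of those it crosses anticlockwise, counted only up to the root. Since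
every vertex reaches the root, there is a j such that all gaps before the j-th are crossed
anticlockwise and all gaps after it clockwise (`exists_le_sum_of_mem_rootedTrees`). The
corresponding mass is P minus the height of the j-th peak above K_i, hence at least P − R(K_i), with
equality at a highest peak. As V ≤ V₊ and V ≤ V₋, the special graph of that peak is optimal, and
equality of the sums forces equality on every arrow (`LiftedChain.optimal`).

For the second, R(y) ≤ V(y, x) + R(x) (`windowRise_le_V`) gives W(x) ≥ P − R(x). Equality holds as
soon as some K_i is joined to x by a one-sided path of cost at most R(K_i) − R(x)
(`IsLabelling.W_eq`). The four cases, comparing window maxima at x and at a neighbouring stable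
component, tell which neighbour provides such a path. -/

/-! ### Lifts, arcs and integrals on the circle. -/

theorem coe_eq_coe_iff {s t : ℝ} : (s : Torus) = (t : Torus) ↔ ∃ n : ℤ, t = s + n := by
  rw [eq_comm, ← sub_eq_zero, ← AddCircle.coe_sub, AddCircle.coe_eq_zero_iff]
  constructor
  · rintro ⟨n, hn⟩
    exact ⟨n, by simp at hn; linarith⟩
  · rintro ⟨n, hn⟩
    exact ⟨n, by simp; linarith⟩

theorem coe_add_int (s : ℝ) (n : ℤ) : ((s + n : ℝ) : Torus) = (s : Torus) :=
  (coe_eq_coe_iff.2 ⟨n, rfl⟩).symm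

theorem coe_add_one (s : ℝ) : ((s + 1 : ℝ) : Torus) = (s : Torus) := by
  exact_mod_cast coe_add_int s 1

/-- Lifts of one point differ by an integer, here of absolute value less than one. Most questions
about arcs are brought back to the real line this way. -/
theorem eq_of_coe_eq {s t : ℝ} (h : (s : Torus) = (t : Torus)) (h1 : s < t + 1) (h2 : t < s + 1) :
    s = t := by
  obtain ⟨n, rfl⟩ := coe_eq_coe_iff.1 h
  have h3 : (n : ℝ) < 1 := by linarith
  have h4 : (-1 : ℝ) < n := by linarith
  have h5 : n < 1 := by exact_mod_cast h3
  have h6 : -1 < n := by exact_mod_cast h4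
  have : n = 0 := by omega
  simp [this]

theorem coe_mem_image {a b v : ℝ} :
    (v : Torus) ∈ (fun s : ℝ => (s : Torus)) '' Icc a b ↔ ∃ n : ℤ, v + n ∈ Icc a b := by
  constructor
  · rintro ⟨s, hs, hsv⟩
    obtain ⟨n, rfl⟩ := coe_eq_coe_iff.1 hsv.symm
    exact ⟨n, hs⟩
  · rintro ⟨n, hn⟩
    exact ⟨_, hn, coe_add_int v n⟩

theorem image_Icc_add_int (a b : ℝ) (n : ℤ) :
    (fun s : ℝ => (s : Torus)) '' Icc (a + n) (b + n) = (fun s : ℝ => (s : Torus)) '' Icc a b := by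
  ext x
  constructor
  · rintro ⟨s, hs, rfl⟩
    exact ⟨s - n, ⟨by linarith [hs.1], by linarith [hs.2]⟩, by simp⟩
  · rintro ⟨s, hs, rfl⟩
    exact ⟨s + n, ⟨by linarith [hs.1], by linarith [hs.2]⟩, coe_add_int s n⟩

/-- Every point of the circle has a lift in `(u, u + 1]`. -/
theorem exists_lift (u : ℝ) (x : Torus) : ∃ v ∈ Ioc u (u + 1), (v : Torus) = x := by
  obtain ⟨s, rfl⟩ := QuotientAddGroup.mk_surjective x
  refine ⟨toIocMod one_pos u s, toIocMod_mem_Ioc _ _ _, ?_⟩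
  rw [toIocMod]
  exact (coe_eq_coe_iff.2 ⟨toIocDiv one_pos u s, by simp⟩)

theorem exists_lift_Ico (u : ℝ) (x : Torus) : ∃ v ∈ Ico u (u + 1), (v : Torus) = x := by
  obtain ⟨s, rfl⟩ := QuotientAddGroup.mk_surjective x
  refine ⟨toIcoMod one_pos u s, toIcoMod_mem_Ico _ _ _, ?_⟩
  rw [toIcoMod]
  exact (coe_eq_coe_iff.2 ⟨toIcoDiv one_pos u s, by simp⟩)

theorem cwDist_coe {s t : ℝ} (h : s ≤ t) (h' : t < s + 1) :
    cwDist (s : Torus) (t : Torus) = t - s := by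
  rw [cwDist, ← AddCircle.coe_sub, AddCircle.coe_equivIco_mk_apply]
  simp only [div_one, mul_one]
  exact Int.fract_eq_self.2 ⟨by linarith, by linarith⟩

theorem cwDist_self (x : Torus) : cwDist x x = 0 := by
  obtain ⟨s, rfl⟩ := QuotientAddGroup.mk_surjective x
  have := cwDist_coe (le_refl s) (by linarith)
  simpa using this

theorem cwIntegral_coe (h : Torus → ℝ) {s t : ℝ} (h1 : s ≤ t) (h2 : t < s + 1) :
    cwIntegral h (s : Torus) (t : Torus) = ∫ r in s..t, h (r : Torus) := by
  rw [cwIntegral, cwDist_coe h1 h2]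
  have := intervalIntegral.integral_comp_add_left (a := 0) (b := t - s)
    (fun r : ℝ => h (r : Torus)) s
  simp only [add_zero, add_sub_cancel] at this
  rw [← this]
  rfl

theorem cwIntegral_self (h : Torus → ℝ) (x : Torus) : cwIntegral h x x = 0 := by
  rw [cwIntegral, cwDist_self, intervalIntegral.integral_same]

theorem cwArc_coe {s t : ℝ} (h1 : s ≤ t) (h2 : t < s + 1) :
    cwArc (s : Torus) (t : Torus) = (fun r : ℝ => (r : Torus)) '' Icc s t := by
  rw [cwArc, cwDist_coe h1 h2]
  ext x
  constructor
  · rintro ⟨r, hr, rfl⟩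
    exact ⟨s + r, ⟨by linarith [hr.1], by linarith [hr.2]⟩, by simp⟩
  · rintro ⟨r, hr, rfl⟩
    exact ⟨r - s, ⟨by linarith [hr.1], by linarith [hr.2]⟩, by simp⟩

theorem isOpen_image_Ioo (a b : ℝ) : IsOpen ((fun s : ℝ => (s : Torus)) '' Ioo a b) :=
  QuotientAddGroup.isOpenMap_coe _ isOpen_Ioo

/-- A connected set avoiding two points of the circle lies in one of the two arcs they bound. -/
theorem subset_arc_of_avoids {C : Set Torus} (hC : IsPreconnected C) {m n t : ℝ}
    (hm : (m : Torus) ∉ C) (hn : (n : Torus) ∉ C) (ht : t ∈ Ioo m n)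
    (htC : (t : Torus) ∈ C) : C ⊆ (fun s : ℝ => (s : Torus)) '' Ioo m n := by
  -- The second open set is the complementary arc; the two arcs are disjoint and miss only the two
  -- excluded points.
  refine hC.subset_left_of_subset_union (isOpen_image_Ioo m n) (isOpen_image_Ioo n (m + 1))
    ?_ ?_ ⟨_, htC, t, ht, rfl⟩
  · rw [Set.disjoint_left]
    rintro _ ⟨s, hs, rfl⟩ ⟨r, hr, hrs⟩
    have := eq_of_coe_eq hrs (by linarith [hs.1, hr.2]) (by linarith [hs.2, hr.1])
    linarith [hs.2, hr.1]
  · intro x hx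
    obtain ⟨v, hv, rfl⟩ := exists_lift m x
    rcases lt_trichotomy v n with h | h | h
    · exact Or.inl ⟨v, ⟨hv.1, h⟩, rfl⟩
    · exact absurd hx (h ▸ hn)
    · refine Or.inr ⟨v, ⟨h, lt_of_le_of_ne hv.2 ?_⟩, rfl⟩
      rintro rfl
      rw [coe_add_one] at hx
      exact hm hx

/-! ### Components of the zero set and sign changes. -/

theorem continuous_lift {F : Torus → ℝ} (hF : Continuous F) : Continuous fun s : ℝ => F (s : Torus) :=
  hF.comp (AddCircle.continuous_mk' 1)

theorem eq_zero_of_mem_connectedComponentIn {F : Torus → ℝ} {x y : Torus}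
    (h : x ∈ connectedComponentIn {z | F z = 0} y) : F x = 0 :=
  connectedComponentIn_subset {z | F z = 0} y h

theorem IsZeroComponent.isPreconnected {F : Torus → ℝ} {C : Set Torus} (hC : IsZeroComponent F C) :
    IsPreconnected C := by
  obtain ⟨x, -, rfl⟩ := hC
  exact isPreconnected_connectedComponentIn

theorem IsZeroComponent.eq_zero {F : Torus → ℝ} {C : Set Torus} (hC : IsZeroComponent F C) {x : Torus}
    (hx : x ∈ C) : F x = 0 := by
  obtain ⟨y, -, rfl⟩ := hC
  exact eq_zero_of_mem_connectedComponentIn hx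

theorem IsZeroComponent.eq_of_mem {F : Torus → ℝ} {C D : Set Torus} (hC : IsZeroComponent F C)
    (hD : IsZeroComponent F D) {x : Torus} (hxC : x ∈ C) (hxD : x ∈ D) : C = D := by
  obtain ⟨y, -, rfl⟩ := hC
  obtain ⟨z, -, rfl⟩ := hD
  rw [connectedComponentIn_eq hxC, connectedComponentIn_eq hxD]

/-- An arc of zeros of `F`, bounded by nonzero values on both sides, is a component. -/
theorem isZeroComponent_image {F : Torus → ℝ} {p q ε : ℝ} (hpq : p ≤ q) (hε : 0 < ε)
    (h0 : ∀ s ∈ Icc p q, F (s : Torus) = 0) (hp : ∀ s ∈ Ico (p - ε) p, F (s : Torus) ≠ 0)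
    (hq : ∀ s ∈ Ioc q (q + ε), F (s : Torus) ≠ 0) :
    IsZeroComponent F ((fun s : ℝ => (s : Torus)) '' Icc p q) := by
  have hp0 : F (p : Torus) = 0 := h0 p ⟨le_rfl, hpq⟩
  -- Otherwise the zeros wrap around the circle and cover the points just before p, where F does not
  -- vanish.
  have hlt : q < p + 1 := by
    by_contra! h
    set δ := min ε 1
    have hδ : 0 < δ := lt_min hε one_pos
    have hδ1 : δ ≤ 1 := min_le_right _ _
    have hδ2 : δ ≤ ε := min_le_left _ _
    refine hp (p - δ) ⟨by linarith, by linarith⟩ ?_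
    rw [← coe_add_one]
    exact h0 _ ⟨by linarith, by linarith⟩
  refine ⟨(p : Torus), hp0, Subset.antisymm ?_ ?_⟩
  · refine IsPreconnected.subset_connectedComponentIn ?_ ⟨p, ⟨le_rfl, hpq⟩, rfl⟩ ?_
    · exact isPreconnected_Icc.image _ (AddCircle.continuous_mk' 1).continuousOn
    · rintro _ ⟨s, hs, rfl⟩
      exact h0 s hs
  · set δ := min ε ((p + 1 - q) / 2)
    have hδ : 0 < δ := lt_min hε (by linarith)
    have hδ1 : δ ≤ ε := min_le_left _ _
    have hδ2 : δ ≤ (p + 1 - q) / 2 := min_le_right _ _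
    have hsub := subset_arc_of_avoids (C := connectedComponentIn {y | F y = 0} (p : Torus))
      isPreconnected_connectedComponentIn (m := p - δ) (n := q + δ) (t := p)
      (fun h => hp (p - δ) ⟨by linarith, by linarith⟩ (eq_zero_of_mem_connectedComponentIn h))
      (fun h => hq (q + δ) ⟨by linarith, by linarith⟩ (eq_zero_of_mem_connectedComponentIn h))
      ⟨by linarith, by linarith⟩ (mem_connectedComponentIn hp0)
    intro x hx
    obtain ⟨s, hs, rfl⟩ := hsub hx
    have hs0 : F (s : Torus) = 0 := eq_zero_of_mem_connectedComponentIn hx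
    refine ⟨s, ⟨?_, ?_⟩, rfl⟩
    · by_contra! h
      exact hp s ⟨by linarith [hs.1], h⟩ hs0
    · by_contra! h
      exact hq s ⟨h, by linarith [hs.2]⟩ hs0

/-- Pigeonhole: zeros accumulating along the filter are shared among finitely many components. -/
theorem frequently_mem_component {F : Torus → ℝ} (hfin : {C : Set Torus | IsZeroComponent F C}.Finite)
    {l : Filter ℝ} (h : ∃ᶠ s : ℝ in l, F (s : Torus) = 0) :
    ∃ C, IsZeroComponent F C ∧ ∃ᶠ s : ℝ in l, (s : Torus) ∈ C := by
  by_contra! hcon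
  have hall : ∀ᶠ s : ℝ in l, ∀ C ∈ {C : Set Torus | IsZeroComponent F C}, (s : Torus) ∉ C := by
    rw [Filter.eventually_all_finite hfin]
    intro C hC
    simpa [Filter.Frequently] using hcon C hC
  refine h (hall.mono fun s hs h0 => ?_)
  exact hs _ ⟨(s : Torus), h0, rfl⟩ (mem_connectedComponentIn h0)

open Filter Topology

/-- If zeros also accumulated at p, one component would contain y < z with nonzeros m, n of F such
that y < m < z < n. Connectedness confines it to the arc (m, n), which y misses. Finiteness of the
set of components thus excludes oscillation. -/
theorem eventually_ne_zero_right {F : Torus → ℝ}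
    (hfin : {C : Set Torus | IsZeroComponent F C}.Finite) {p : ℝ}
    (h : ∃ᶠ s : ℝ in 𝓝[>] p, F (s : Torus) ≠ 0) : ∀ᶠ s : ℝ in 𝓝[>] p, F (s : Torus) ≠ 0 := by
  by_contra hcon
  have hcon : ∃ᶠ s : ℝ in 𝓝[>] p, F (s : Torus) = 0 :=
    (not_eventually.1 hcon).mono fun s h => not_not.1 h
  obtain ⟨C, hC, hfr⟩ := frequently_mem_component hfin hcon
  have nhds (r : ℝ) (hr : p < r) : ∀ᶠ s in 𝓝[>] p, s ∈ Ioo p r := Ioo_mem_nhdsGT hr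
  obtain ⟨n, hn0, hn⟩ := (h.and_eventually (nhds (p + 1) (by linarith))).exists
  obtain ⟨z, hz0, hz⟩ := (hfr.and_eventually (nhds n hn.1)).exists
  obtain ⟨m, hm0, hm⟩ := (h.and_eventually (nhds z hz.1)).exists
  obtain ⟨y, hy0, hy⟩ := (hfr.and_eventually (nhds m hm.1)).exists
  obtain ⟨t, ht, hty⟩ := subset_arc_of_avoids hC.isPreconnected (m := m) (n := n) (t := z)
    (fun h => hm0 (hC.eq_zero h))
    (fun h => hn0 (hC.eq_zero h)) ⟨hm.2, hz.2⟩ hz0 hy0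
  have := eq_of_coe_eq hty (by linarith [ht.2, hn.2, hy.1]) (by linarith [ht.1, hy.2])
  linarith [ht.1, hy.2]

theorem eventually_ne_zero_left {F : Torus → ℝ}
    (hfin : {C : Set Torus | IsZeroComponent F C}.Finite) {p : ℝ}
    (h : ∃ᶠ s : ℝ in 𝓝[<] p, F (s : Torus) ≠ 0) : ∀ᶠ s : ℝ in 𝓝[<] p, F (s : Torus) ≠ 0 := by
  by_contra hcon
  have hcon : ∃ᶠ s : ℝ in 𝓝[<] p, F (s : Torus) = 0 :=
    (not_eventually.1 hcon).mono fun s h => not_not.1 h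
  obtain ⟨C, hC, hfr⟩ := frequently_mem_component hfin hcon
  have nhds (r : ℝ) (hr : r < p) : ∀ᶠ s in 𝓝[<] p, s ∈ Ioo r p := Ioo_mem_nhdsLT hr
  obtain ⟨n, hn0, hn⟩ := (h.and_eventually (nhds (p - 1) (by linarith))).exists
  obtain ⟨z, hz0, hz⟩ := (hfr.and_eventually (nhds n hn.2)).exists
  obtain ⟨m, hm0, hm⟩ := (h.and_eventually (nhds z hz.2)).exists
  obtain ⟨y, hy0, hy⟩ := (hfr.and_eventually (nhds m hm.2)).exists
  obtain ⟨t, ht, hty⟩ := subset_arc_of_avoids hC.isPreconnected (m := n) (n := m) (t := z)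
    (fun h => hn0 (hC.eq_zero h))
    (fun h => hm0 (hC.eq_zero h)) ⟨hz.1, hm.1⟩ hz0 hy0
  have := eq_of_coe_eq hty (by linarith [ht.2, hy.1]) (by linarith [hn.1, ht.1, hy.2])
  linarith [ht.2, hy.1]

/-- Between a negative and a later positive value there is a stable component. -/
theorem exists_stable_between {F : Torus → ℝ} (hF : Continuous F)
    (hfin : {C : Set Torus | IsZeroComponent F C}.Finite) {s t : ℝ} (hst : s < t)
    (hs : F (s : Torus) < 0) (ht : 0 < F (t : Torus)) :
    ∃ p q ε : ℝ, s < p ∧ p ≤ q ∧ q < t ∧ 0 < ε ∧ (∀ r ∈ Icc p q, F (r : Torus) = 0) ∧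
      (∀ r ∈ Ico (p - ε) p, F (r : Torus) < 0) ∧ (∀ r ∈ Ioc q (q + ε), 0 < F (r : Torus)) ∧
      IsStable F ((fun r : ℝ => (r : Torus)) '' Icc p q) := by
  have hc := continuous_lift hF
  -- The component is [p, q], with p the supremum of the points of negativity and q the first limit
  -- of positivity after p; in between F is neither negative nor positive.
  set A := {r | r ∈ Icc s t ∧ F (r : Torus) < 0} with hA
  have hAne : A.Nonempty := ⟨s, ⟨le_rfl, hst.le⟩, hs⟩
  have hAbdd : BddAbove A := ⟨t, fun r hr => hr.1.2⟩
  set p := sSup A with hp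
  have hpub : ∀ r ∈ A, r ≤ p := fun r hr => le_csSup hAbdd hr
  have hpt : p ≤ t := csSup_le hAne fun r hr => hr.1.2
  have hsp : s ≤ p := hpub s ⟨⟨le_rfl, hst.le⟩, hs⟩
  have hpos : ∀ r ∈ Ioc p t, 0 ≤ F (r : Torus) := fun r hr => by
    by_contra! h
    linarith [hr.1, hpub r ⟨⟨hsp.trans hr.1.le, hr.2⟩, h⟩]
  have hple : F (p : Torus) ≤ 0 := by
    have : p ∈ closure A := csSup_mem_closure hAne hAbdd
    exact closure_minimal (fun r hr => hr.2.le) (isClosed_le hc continuous_const) this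
  have hplt : p < t := lt_of_le_of_ne hpt (by rintro h; rw [h] at hple; linarith)
  have hp0 : F (p : Torus) = 0 := by
    refine le_antisymm hple ?_
    have : p ∈ closure (Ioc p t) := by
      rw [closure_Ioc hplt.ne]; exact ⟨le_rfl, hpt⟩
    exact closure_minimal (fun r hr => hpos r hr) (isClosed_le continuous_const hc) this
  have hsp' : s < p := lt_of_le_of_ne hsp (by rintro h; rw [← h] at hp0; linarith)
  have hfrl : ∀ r < p, ∃ r' ∈ A, r' ∈ Ioo r p := by
    intro r hr
    obtain ⟨r', hr', hlt⟩ := exists_lt_of_lt_csSup hAne hr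
    refine ⟨r', hr', hlt, lt_of_le_of_ne (hpub r' hr') ?_⟩
    rintro rfl
    linarith [hr'.2]
  have hevl : ∀ᶠ r : ℝ in 𝓝[<] p, F (r : Torus) ≠ 0 := by
    refine eventually_ne_zero_left hfin ?_
    rw [(nhdsLT_basis p).frequently_iff]
    intro r hr
    obtain ⟨r', hr', h⟩ := hfrl r hr
    exact ⟨r', h, hr'.2.ne⟩
  obtain ⟨l, hl, hlne⟩ := (nhdsLT_basis p).eventually_iff.1 hevl
  set B := {r | r ∈ Icc p t ∧ 0 < F (r : Torus)} with hB
  have hBne : B.Nonempty := ⟨t, ⟨hpt, le_rfl⟩, ht⟩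
  have hBbdd : BddBelow B := ⟨p, fun r hr => hr.1.1⟩
  set q := sInf B with hq
  have hqlb : ∀ r ∈ B, q ≤ r := fun r hr => csInf_le hBbdd hr
  have hpq : p ≤ q := le_csInf hBne fun r hr => hr.1.1
  have hqt : q ≤ t := hqlb t ⟨⟨hpt, le_rfl⟩, ht⟩
  have hlow : ∀ r ∈ Ico p q, F (r : Torus) = 0 := fun r hr => by
    rcases hr.1.eq_or_lt with h | h
    · rw [← h, hp0]
    · refine le_antisymm ?_ (hpos r ⟨h, by linarith [hr.2]⟩)
      by_contra! h'
      linarith [hr.2, hqlb r ⟨⟨hr.1, by linarith [hr.2]⟩, h'⟩]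
  have hq0 : F (q : Torus) = 0 := by
    rcases hpq.eq_or_lt with h | h
    · rw [← h, hp0]
    · have : q ∈ closure (Ico p q) := by
        rw [closure_Ico h.ne]; exact ⟨hpq, le_rfl⟩
      exact closure_minimal (fun r hr => hlow r hr) (isClosed_eq hc continuous_const) this
  have hqt' : q < t := lt_of_le_of_ne hqt (by rintro h; rw [h] at hq0; linarith)
  have hevr : ∀ᶠ r : ℝ in 𝓝[>] q, F (r : Torus) ≠ 0 := by
    refine eventually_ne_zero_right hfin ?_
    rw [(nhdsGT_basis q).frequently_iff]
    intro r hr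
    obtain ⟨r', hr', hlt⟩ := exists_lt_of_csInf_lt hBne hr
    refine ⟨r', ⟨lt_of_le_of_ne (hqlb r' hr') ?_, hlt⟩, hr'.2.ne'⟩
    rintro h
    rw [← h] at hr'
    linarith [hr'.2]
  obtain ⟨g, hg, hgne⟩ := (nhdsGT_basis q).eventually_iff.1 hevr
  set ε := min ((p - l) / 2) (min ((g - q) / 2) (t - q)) with hε
  have e0 : 0 < ε := lt_min (by linarith) (lt_min (by linarith) (by linarith))
  have e1 : ε ≤ (p - l) / 2 := min_le_left _ _
  have e2 : ε ≤ (g - q) / 2 := (min_le_right _ _).trans (min_le_left _ _)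
  have e3 : ε ≤ t - q := (min_le_right _ _).trans (min_le_right _ _)
  -- Negative values occur arbitrarily close to p, so a nonnegative value here would produce a zero
  -- in the zero-free left neighbourhood.
  have hneg : ∀ r ∈ Ico (p - ε) p, F (r : Torus) < 0 := by
    intro r hr
    by_contra! h
    obtain ⟨r', hr', hrr⟩ := hfrl r hr.2
    obtain ⟨z, hz, hz0⟩ := intermediate_value_Icc' hrr.1.le (hc.continuousOn)
      (show (0 : ℝ) ∈ Icc (F (r' : Torus)) (F (r : Torus)) from ⟨hr'.2.le, h⟩)
    exact hlne ⟨by linarith [hz.1, hr.1], by linarith [hz.2, hrr.2]⟩ hz0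
  have hpo : ∀ r ∈ Ioc q (q + ε), 0 < F (r : Torus) := by
    intro r hr
    refine lt_of_le_of_ne (hpos r ⟨by linarith [hr.1], by linarith [hr.2]⟩) (Ne.symm ?_)
    exact hgne ⟨hr.1, by linarith [hr.2]⟩
  have hzero : ∀ r ∈ Icc p q, F (r : Torus) = 0 := by
    intro r hr
    rcases hr.2.eq_or_lt with h | h
    · rw [h, hq0]
    · exact hlow r ⟨hr.1, h⟩
  exact ⟨p, q, ε, hsp', hpq, hqt', e0, hzero, hneg, hpo,
    isZeroComponent_image hpq e0 hzero (fun r hr => (hneg r hr).ne) (fun r hr => (hpo r hr).ne'),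
    p, q, hpq, rfl, ε, e0, hneg, hpo⟩

theorem isZeroComponent_neg {F : Torus → ℝ} {C : Set Torus} :
    IsZeroComponent (fun x => -F x) C ↔ IsZeroComponent F C := by
  simp [IsZeroComponent]

/-- Replacing F by −F transfers the results on stable components to totally unstable ones. -/
theorem isStable_neg {F : Torus → ℝ} {C : Set Torus} :
    IsStable (fun x => -F x) C ↔ IsTotallyUnstable F C := by
  simp [IsStable, IsTotallyUnstable, isZeroComponent_neg]

/-- Between a positive and a later negative value there is a totally unstable component. -/
theorem exists_totallyUnstable_between {F : Torus → ℝ} (hF : Continuous F)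
    (hfin : {C : Set Torus | IsZeroComponent F C}.Finite) {s t : ℝ} (hst : s < t)
    (hs : 0 < F (s : Torus)) (ht : F (t : Torus) < 0) :
    ∃ p q ε : ℝ, s < p ∧ p ≤ q ∧ q < t ∧ 0 < ε ∧ (∀ r ∈ Icc p q, F (r : Torus) = 0) ∧
      (∀ r ∈ Ico (p - ε) p, 0 < F (r : Torus)) ∧ (∀ r ∈ Ioc q (q + ε), F (r : Torus) < 0) ∧
      IsTotallyUnstable F ((fun r : ℝ => (r : Torus)) '' Icc p q) := by
  have := exists_stable_between (F := fun x => -F x) hF.neg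
    (by simpa only [isZeroComponent_neg] using hfin) hst (by linarith) (by linarith)
  simpa only [isStable_neg, neg_eq_zero, neg_lt_zero, neg_pos] using this

/-- The interval in the definition is translated by an integer to reach u. It is shorter than one
turn, since otherwise it would cover the points before a where F is negative. -/
theorem IsStable.exists_lift {F : Torus → ℝ} {C : Set Torus} (hC : IsStable F C) {u : ℝ}
    (hu : (u : Torus) ∈ C) : ∃ a b ε : ℝ, u ∈ Icc a b ∧ b < a + 1 ∧
      C = (fun s : ℝ => (s : Torus)) '' Icc a b ∧ (∀ s ∈ Icc a b, F (s : Torus) = 0) ∧ 0 < ε ∧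
      (∀ s ∈ Ico (a - ε) a, F (s : Torus) < 0) ∧ (∀ s ∈ Ioc b (b + ε), 0 < F (s : Torus)) := by
  obtain ⟨hcomp, a, b, hab, rfl, ε, hε, hneg, hpos⟩ := hC
  obtain ⟨n, hn⟩ := coe_mem_image.1 hu
  have hzero : ∀ s ∈ Icc a b, F (s : Torus) = 0 := fun s hs => hcomp.eq_zero ⟨s, hs, rfl⟩
  refine ⟨a - n, b - n, ε, ⟨by linarith [hn.1], by linarith [hn.2]⟩, ?_, ?_, ?_, hε, ?_, ?_⟩
  · by_contra! h
    set δ := min ε 1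
    have hδ : 0 < δ := lt_min hε one_pos
    have hδ1 : δ ≤ 1 := min_le_right _ _
    have hδ2 : δ ≤ ε := min_le_left _ _
    have h1 := hneg (a - δ) ⟨by linarith, by linarith⟩
    have h2 := hzero (a - δ + 1) ⟨by linarith, by linarith⟩
    rw [coe_add_one] at h2
    linarith
  · simpa using image_Icc_add_int (a - n) (b - n) n
  all_goals
    intro s hs
    rw [← coe_add_int s n]
  · exact hzero _ ⟨by linarith [hs.1], by linarith [hs.2]⟩
  · exact hneg _ ⟨by linarith [hs.1], by linarith [hs.2]⟩
  · exact hpos _ ⟨by linarith [hs.1], by linarith [hs.2]⟩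

theorem IsTotallyUnstable.exists_lift {F : Torus → ℝ} {C : Set Torus} (hC : IsTotallyUnstable F C)
    {u : ℝ} (hu : (u : Torus) ∈ C) : ∃ a b ε : ℝ, u ∈ Icc a b ∧ b < a + 1 ∧
      C = (fun s : ℝ => (s : Torus)) '' Icc a b ∧ (∀ s ∈ Icc a b, F (s : Torus) = 0) ∧ 0 < ε ∧
      (∀ s ∈ Ico (a - ε) a, 0 < F (s : Torus)) ∧ (∀ s ∈ Ioc b (b + ε), F (s : Torus) < 0) := by
  simpa only [neg_eq_zero, neg_lt_zero, neg_pos] using (isStable_neg.2 hC).exists_lift hu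

theorem coe_notMem_image {a b z : ℝ} (hb : b < z) (ha : z < a + 1) :
    (z : Torus) ∉ (fun s : ℝ => (s : Torus)) '' Icc a b := by
  intro h
  obtain ⟨n, hn⟩ := coe_mem_image.1 h
  have h1 : (n : ℝ) < 0 := by linarith [hn.2]
  have h2 : (-1 : ℝ) < n := by linarith [hn.1]
  have h3 : n < 0 := by exact_mod_cast h1
  have h4 : -1 < n := by exact_mod_cast h2
  omega

theorem IsZeroComponent.nonempty {F : Torus → ℝ} {C : Set Torus} (hC : IsZeroComponent F C) :
    C.Nonempty := by
  obtain ⟨x, hx, rfl⟩ := hC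
  exact ⟨x, mem_connectedComponentIn hx⟩

theorem pt_mem {C : Set Torus} (hC : C.Nonempty) : pt C ∈ C := Classical.epsilon_spec hC

/-! ### Cyclic order of the stable components and the gaps between them. -/

section Labelling

variable {F : Torus → ℝ} {ℓ : ℕ} {K : ZMod ℓ → Set Torus}

theorem IsLabelling.isStable (hK : IsLabelling F K) (i : ZMod ℓ) : IsStable F (K i) :=
  hK.1.mapsTo (mem_univ i)

theorem IsLabelling.pt_mem (hK : IsLabelling F K) (i : ZMod ℓ) : pt (K i) ∈ K i :=
  FW.pt_mem (hK.isStable i).1.nonempty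

theorem IsLabelling.eq_of_mem (hK : IsLabelling F K) {i j : ZMod ℓ} {x : Torus} (hi : x ∈ K i)
    (hj : x ∈ K j) : i = j :=
  hK.1.injOn (mem_univ i) (mem_univ j) ((hK.isStable i).1.eq_of_mem (hK.isStable j).1 hi hj)

theorem eq_one_of_eq_add_one {i : ZMod ℓ} (h : i = i + 1) : ℓ = 1 := by
  have h1 : (1 : ZMod ℓ) = 0 := by simpa using h.symm
  have h2 : ((1 : ℕ) : ZMod ℓ) = 0 := by exact_mod_cast h1
  rw [ZMod.natCast_eq_zero_iff] at h2
  exact Nat.dvd_one.1 h2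

/-- Lifts of two consecutive stable components. -/
theorem IsLabelling.exists_lifts (hK : IsLabelling F K) {i : ZMod ℓ} {u w : ℝ}
    (hu : (u : Torus) ∈ K i) (hw : (w : Torus) ∈ K (i + 1)) (huw : w ∈ Ioc u (u + 1))
    (h1 : ℓ = 1 → (u : Torus) = (w : Torus)) :
    ∃ a b a' b' ε : ℝ, u ∈ Icc a b ∧ w ∈ Icc a' b' ∧ b < a' ∧ a' ≤ a + 1 ∧ b' ≤ b + 1 ∧ 0 < ε ∧
      K i = (fun s : ℝ => (s : Torus)) '' Icc a b ∧
      K (i + 1) = (fun s : ℝ => (s : Torus)) '' Icc a' b' ∧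
      (∀ s ∈ Icc a b, F (s : Torus) = 0) ∧ (∀ s ∈ Icc a' b', F (s : Torus) = 0) ∧
      (∀ s ∈ Ioc b (b + ε), 0 < F (s : Torus)) ∧ (∀ s ∈ Ico (a' - ε) a', F (s : Torus) < 0) := by
  obtain ⟨a, b, ε₁, hab, hba, hC, hz, hε₁, hneg, hpos⟩ := (hK.isStable i).exists_lift hu
  obtain ⟨a', b', ε₂, hab', hba', hC', hz', hε₂, hneg', hpos'⟩ := (hK.isStable (i + 1)).exists_lift hw
  set ε := min ε₁ ε₂
  have e0 : 0 < ε := lt_min hε₁ hε₂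
  have e1 : ε ≤ ε₁ := min_le_left _ _
  have e2 : ε ≤ ε₂ := min_le_right _ _
  obtain ⟨hab1, hab2⟩ := hab
  obtain ⟨hab1', hab2'⟩ := hab'
  obtain ⟨huw1, huw2⟩ := huw
  have hzp : ∀ s ∈ Icc (a + 1) (b + 1), F (s : Torus) = 0 := fun s hs => by
    have := hz (s - 1) ⟨by linarith [hs.1], by linarith [hs.2]⟩
    rwa [← coe_add_one, sub_add_cancel] at this
  have hposp : ∀ s ∈ Ioc (b + 1) (b + 1 + ε₁), 0 < F (s : Torus) := fun s hs => by
    have := hpos (s - 1) ⟨by linarith [hs.1], by linarith [hs.2]⟩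
    rwa [← coe_add_one, sub_add_cancel] at this
  -- If w were in [a, b], the two components would coincide and ℓ = 1; then w = u + 1, which exceeds
  -- b.
  have hbw : b < w := by
    by_contra! h
    have hwi : (w : Torus) ∈ K i := hC ▸ ⟨w, ⟨by linarith, h⟩, rfl⟩
    have hℓ := eq_one_of_eq_add_one (hK.eq_of_mem hwi hw)
    have := eq_of_coe_eq ((coe_add_one u).trans (h1 hℓ)) (by linarith) (by linarith)
    linarith
  -- If this or either of the next two inequalities failed, some point would lie both in an interval
  -- of zeros and in a flank where F is nonzero.
  have h2 : b < a' := by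
    by_contra! h
    set δ := min ε (w - b)
    have hδ : 0 < δ := lt_min e0 (by linarith)
    have hδ1 : δ ≤ ε := min_le_left _ _
    have hδ2 : δ ≤ w - b := min_le_right _ _
    have := hpos (b + δ) ⟨by linarith, by linarith⟩
    have := hz' (b + δ) ⟨by linarith, by linarith⟩
    linarith
  have h3 : a' ≤ a + 1 := by
    by_contra! h
    set δ := min ε (a' - (a + 1))
    have hδ : 0 < δ := lt_min e0 (by linarith)
    have hδ1 : δ ≤ ε := min_le_left _ _
    have hδ2 : δ ≤ a' - (a + 1) := min_le_right _ _
    have := hneg' (a' - δ) ⟨by linarith, by linarith⟩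
    have := hzp (a' - δ) ⟨by linarith, by linarith⟩
    linarith
  have h4 : b' ≤ b + 1 := by
    by_contra! h
    set δ := min ε (b' - (b + 1))
    have hδ : 0 < δ := lt_min e0 (by linarith)
    have hδ1 : δ ≤ ε := min_le_left _ _
    have hδ2 : δ ≤ b' - (b + 1) := min_le_right _ _
    have := hposp (b + 1 + δ) ⟨by linarith, by linarith⟩
    have := hz' (b + 1 + δ) ⟨by linarith, by linarith⟩
    linarith
  exact ⟨a, b, a', b', ε, ⟨hab1, hab2⟩, ⟨hab1', hab2'⟩, h2, h3, h4, e0, hC, hC', hz, hz',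
    fun s hs => hpos s ⟨hs.1, by linarith [hs.2]⟩, fun s hs => hneg' s ⟨by linarith [hs.1], hs.2⟩⟩

/-- Cyclic betweenness becomes an inequality between lifts. For ℓ = 1 one has w = u + 1, so the
inequality only says that the point is not in the component. -/
theorem IsLabelling.between_iff (hK : IsLabelling F K) {i : ZMod ℓ} {u v w : ℝ}
    (hu : (u : Torus) ∈ K i) (hw : (w : Torus) ∈ K (i + 1)) (huw : w ∈ Ioc u (u + 1))
    (h1 : ℓ = 1 → (u : Torus) = (w : Torus)) (hv : v ∈ Ioc u (u + 1))
    (hvi : (v : Torus) ∉ K i) (hvi' : (v : Torus) ∉ K (i + 1)) :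
    Between (K i) (v : Torus) (K (i + 1)) ↔ v < w := by
  constructor
  · rintro ⟨-, -, h⟩
    by_cases hii : i = i + 1
    · have hℓ := eq_one_of_eq_add_one hii
      have hwu := eq_of_coe_eq ((coe_add_one u).trans (h1 hℓ)) (by linarith [huw.1])
        (by linarith [huw.2])
      refine lt_of_le_of_ne (hwu ▸ hv.2) ?_
      rintro rfl
      exact hvi' hw
    · have hle : LeLe (K i) v (K (i + 1)) := h.resolve_left fun h =>
        hii (hK.1.injOn (mem_univ _) (mem_univ _) h)
      obtain ⟨a, b, a', b', ε, hab, hab', hba, haa, hbb, hε, hC, hC', -⟩ :=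
        hK.exists_lifts hu hw huw h1
      -- With distinct components, every clockwise path from one to the other is then shorter than a
      -- turn and can be computed on the line.
      have hlt : b' < a + 1 := by
        by_contra! hcon
        have ha1 : (a : Torus) ∈ K i := hC ▸ ⟨a, ⟨le_rfl, hab.1.trans hab.2⟩, rfl⟩
        have ha2 : (a : Torus) ∈ K (i + 1) := by
          rw [← coe_add_one, hC']
          exact ⟨a + 1, ⟨haa, hcon⟩, rfl⟩
        exact hii (hK.eq_of_mem ha1 ha2)
      obtain ⟨x, hx, y, hy, hv2⟩ := hle
      rw [hC] at hx
      rw [hC'] at hy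
      obtain ⟨α, hα, rfl⟩ := hx
      obtain ⟨β, hβ, rfl⟩ := hy
      rw [cwArc_coe (by linarith [hα.2, hβ.1]) (by linarith [hα.1, hβ.2])] at hv2
      obtain ⟨r, hr, hrv⟩ := hv2
      simp only at hrv
      have hr1 : b < r := by
        by_contra! hcon
        exact hvi (hC ▸ ⟨r, ⟨hα.1.trans hr.1, hcon⟩, hrv⟩)
      have hr2 : r < a' := by
        by_contra! hcon
        exact hvi' (hC' ▸ ⟨r, ⟨hcon, hr.2.trans hβ.2⟩, hrv⟩)
      have := eq_of_coe_eq hrv (by linarith [hab.1, hv.1]) (by linarith [hab.2, hv.2])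
      linarith [hab'.1]
  · intro hvw
    refine ⟨hvi, hvi', ?_⟩
    rcases huw.2.eq_or_lt with hlt | hlt
    · refine Or.inl (congrArg K (hK.eq_of_mem hu ?_))
      rw [← coe_add_one, ← hlt]
      exact hw
    · refine Or.inr ⟨u, hu, w, hw, ?_⟩
      rw [cwArc_coe huw.1.le hlt]
      exact ⟨v, ⟨hv.1.le, hvw.le⟩, rfl⟩

/-- The shape of `F` between two consecutive stable components. -/
theorem IsLabelling.exists_gap (hF : Continuous F)
    (hfin : {C : Set Torus | IsZeroComponent F C}.Finite) (hK : IsLabelling F K) {i : ZMod ℓ}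
    {u w : ℝ} (hu : (u : Torus) ∈ K i) (hw : (w : Torus) ∈ K (i + 1)) (huw : w ∈ Ioc u (u + 1))
    (h1 : ℓ = 1 → (u : Torus) = (w : Torus)) :
    ∃ c d : ℝ, u < c ∧ c ≤ d ∧ d < w ∧
      unstableBetween F K i = (fun s : ℝ => (s : Torus)) '' Icc c d ∧
      (∀ s ∈ Icc u d, 0 ≤ F (s : Torus)) ∧ (∀ s ∈ Icc c w, F (s : Torus) ≤ 0) := by
  obtain ⟨a, b, a', b', ε, hab, hab', hba, haa, hbb, hε, hC, hC', hz, hz', hpos, hneg⟩ :=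
    hK.exists_lifts hu hw huw h1
  have hnot : ∀ z ∈ Ioo b a', (z : Torus) ∉ K i ∧ (z : Torus) ∉ K (i + 1) := by
    intro z hz
    constructor
    · rw [hC]
      exact coe_notMem_image hz.1 (by linarith [hz.2])
    · rw [hC', ← coe_add_one]
      exact coe_notMem_image (by linarith [hz.1]) (by linarith [hz.2])
  have hbetw : ∀ z ∈ Ioo b a', Between (K i) (z : Torus) (K (i + 1)) := fun z hz =>
    (hK.between_iff hu hw huw h1 ⟨by linarith [hab.2, hz.1], by linarith [hab.1, hz.2]⟩
      (hnot z hz).1 (hnot z hz).2).2 (by linarith [hab'.1, hz.2])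
  -- A passage from negative to positive would create a stable component inside the gap, against the
  -- labelling.
  have hsign : ∀ s ∈ Ioo b a', ∀ t ∈ Ioo b a', s < t → F (s : Torus) < 0 → F (t : Torus) ≤ 0 := by
    intro s hs t ht hst hs0
    by_contra! ht0
    obtain ⟨p, q, -, hsp, hpq, hqt, -, -, -, -, hstab⟩ := exists_stable_between hF hfin hst hs0 ht0
    obtain ⟨j, -, hj⟩ := hK.1.surjOn hstab
    refine hK.2 i j (p : Torus) (hj ▸ ⟨p, ⟨le_rfl, hpq⟩, rfl⟩) (hbetw p ⟨?_, ?_⟩)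
    · linarith [hs.1]
    · linarith [ht.2]
  set δ := min ε ((a' - b) / 3)
  have hδ : 0 < δ := lt_min hε (by linarith)
  have hδ1 : δ ≤ ε := min_le_left _ _
  have hδ2 : δ ≤ (a' - b) / 3 := min_le_right _ _
  obtain ⟨c, d, η, hbc, hcd, hda, hη, hcz, hcpos, hdneg, hun⟩ := exists_totallyUnstable_between hF hfin
    (s := b + δ) (t := a' - δ) (by linarith) (hpos _ ⟨by linarith, by linarith⟩)
    (hneg _ ⟨by linarith, by linarith⟩)
  refine ⟨c, d, by linarith [hab.2], hcd, by linarith [hab'.1], ?_, ?_, ?_⟩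
  · apply Subset.antisymm
    · rintro x ⟨E, ⟨hE, hEb⟩, hxE⟩
      obtain ⟨v, hv, rfl⟩ := FW.exists_lift u x
      have hvb := hEb _ hxE
      have hvw := (hK.between_iff hu hw huw h1 hv hvb.1 hvb.2.1).1 hvb
      obtain ⟨c', d', η', hcd', -, hE', hEz, hη', hEpos, hEneg⟩ := hE.exists_lift hxE
      have hbv : b < v := by
        by_contra! h
        exact hvb.1 (hC ▸ ⟨v, ⟨by linarith [hab.1, hv.1], h⟩, rfl⟩)
      have hva : v < a' := by
        by_contra! h
        exact hvb.2.1 (hC' ▸ ⟨v, ⟨h, by linarith [hab'.2]⟩, rfl⟩)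
      have hbc' : b < c' := by
        by_contra! h
        have hbE : (b : Torus) ∈ E := hE' ▸ ⟨b, ⟨h, by linarith [hcd'.2]⟩, rfl⟩
        exact (hEb _ hbE).1 (hC ▸ ⟨b, ⟨hab.1.trans hab.2, le_rfl⟩, rfl⟩)
      have hda' : d' < a' := by
        by_contra! h
        have haE : (a' : Torus) ∈ E := hE' ▸ ⟨a', ⟨by linarith [hcd'.1], h⟩, rfl⟩
        exact (hEb _ haE).2.1 (hC' ▸ ⟨a', ⟨le_rfl, hab'.1.trans hab'.2⟩, rfl⟩)
      -- Two disjoint totally unstable intervals in the gap would force F to be negative after the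
      -- first and positive before the second. Hence they overlap, and the components are equal.
      have key : ∀ c₁ d₁ c₂ η₁ η₂ : ℝ, b < c₁ → c₁ ≤ d₁ → d₁ < c₂ → c₂ < a' → 0 < η₁ → 0 < η₂ →
          (∀ r ∈ Ioc d₁ (d₁ + η₁), F (r : Torus) < 0) →
          (∀ r ∈ Ico (c₂ - η₂) c₂, 0 < F (r : Torus)) → False := by
        intro c₁ d₁ c₂ η₁ η₂ g1 g2 g3 g4 g5 g6 g7 g8
        set κ := min (min η₁ η₂) ((c₂ - d₁) / 3)
        have k0 : 0 < κ := lt_min (lt_min g5 g6) (by linarith)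
        have k1 : κ ≤ η₁ := (min_le_left _ _).trans (min_le_left _ _)
        have k2 : κ ≤ η₂ := (min_le_left _ _).trans (min_le_right _ _)
        have k3 : κ ≤ (c₂ - d₁) / 3 := min_le_right _ _
        have m1 := g7 (d₁ + κ) ⟨by linarith, by linarith⟩
        have m2 := g8 (c₂ - κ) ⟨by linarith, by linarith⟩
        have := hsign (d₁ + κ) ⟨by linarith, by linarith⟩ (c₂ - κ) ⟨by linarith, by linarith⟩
          (by linarith) m1
        linarith
      have hle1 : c' ≤ d := by
        by_contra! h
        exact key c d c' η η' (by linarith) hcd h (by linarith [hcd'.1]) hη hη' hdneg hEpos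
      have hle2 : c ≤ d' := by
        by_contra! h
        exact key c' d' c η' η hbc' (hcd'.1.trans hcd'.2) h (by linarith) hη' hη hEneg hcpos
      have hm1 : ((max c c' : ℝ) : Torus) ∈ E :=
        hE' ▸ ⟨max c c', ⟨le_max_right _ _, max_le hle2 (hcd'.1.trans hcd'.2)⟩, rfl⟩
      have hm2 : ((max c c' : ℝ) : Torus) ∈ (fun s : ℝ => (s : Torus)) '' Icc c d :=
        ⟨max c c', ⟨le_max_left _ _, max_le hcd hle1⟩, rfl⟩
      rw [← hE.1.eq_of_mem hun.1 hm1 hm2]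
      exact hxE
    · intro x hx
      refine ⟨_, ⟨hun, ?_⟩, hx⟩
      rintro _ ⟨s, hs, rfl⟩
      exact hbetw s ⟨by linarith [hs.1], by linarith [hs.2]⟩
  · intro s hs
    rcases le_or_gt s b with h | h
    · rw [hz s ⟨hab.1.trans hs.1, h⟩]
    rcases le_or_gt c s with h' | h'
    · rw [hcz s ⟨h', hs.2⟩]
    set κ := min η ((c - s) / 2)
    have k0 : 0 < κ := lt_min hη (by linarith)
    have k1 : κ ≤ η := min_le_left _ _
    have k2 : κ ≤ (c - s) / 2 := min_le_right _ _
    by_contra! h0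
    have := hcpos (c - κ) ⟨by linarith, by linarith⟩
    have := hsign s ⟨h, by linarith⟩ (c - κ) ⟨by linarith, by linarith⟩ (by linarith) h0
    linarith
  · intro s hs
    rcases le_or_gt a' s with h | h
    · rw [hz' s ⟨h, hs.2.trans hab'.2⟩]
    rcases le_or_gt s d with h' | h'
    · rw [hcz s ⟨hs.1, h'⟩]
    set κ := min η ((s - d) / 2)
    have k0 : 0 < κ := lt_min hη (by linarith)
    have k1 : κ ≤ η := min_le_left _ _
    have k2 : κ ≤ (s - d) / 2 := min_le_right _ _
    have := hdneg (d + κ) ⟨by linarith, by linarith⟩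
    exact hsign (d + κ) ⟨by linarith, by linarith⟩ s ⟨by linarith, h⟩ (by linarith) this

/-- The lifts of the chosen points of the stable components, in increasing order. -/
theorem IsLabelling.exists_chain [NeZero ℓ] (hK : IsLabelling F K) {i : ZMod ℓ} {u : ℝ}
    (hu : (u : Torus) = pt (K i)) :
    ∃ k : ℕ → ℝ, k 0 = u ∧ k ℓ = u + 1 ∧ (∀ n ≤ ℓ, (k n : Torus) = pt (K (i + n))) ∧
      (∀ n < ℓ, k n < k (n + 1)) ∧ Monotone k := by
  choose f hf hf' using fun n : ℕ => FW.exists_lift_Ico u (pt (K (i + n)))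
  have hℓ : 0 < ℓ := Nat.pos_of_ne_zero (NeZero.ne ℓ)
  have hf0 : f 0 = u := by
    refine eq_of_coe_eq ?_ (hf 0).2 (by linarith [(hf 0).1])
    rw [hf', hu, Nat.cast_zero, add_zero]
  have huK : (u : Torus) ∈ K i := hu ▸ hK.pt_mem i
  have hfK : ∀ n : ℕ, (f n : Torus) ∈ K (i + n) := fun n => hf' n ▸ hK.pt_mem _
  have hne : ∀ n, 0 < n → n < ℓ → i ≠ i + (n : ZMod ℓ) := by
    intro n h0 hn h
    have : (n : ZMod ℓ) = 0 := by simpa using h.symm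
    rw [ZMod.natCast_eq_zero_iff] at this
    exact absurd (Nat.le_of_dvd h0 this) (by omega)
  -- At n = ℓ the lift in [u, u + 1) would be u again; the chain has to close at u + 1.
  set k : ℕ → ℝ := fun n => if n < ℓ then f n else u + 1 with hk
  suffices hlt : ∀ n < ℓ, k n < k (n + 1) by
    refine ⟨k, by simp [hk, hℓ, hf0], by simp [hk], ?_, hlt, monotone_nat_of_le_succ fun n => ?_⟩
    · intro n hn
      simp only [hk]
      split_ifs with h
      · exact hf' n
      · have : n = ℓ := by omega
        simp [this, hu]
    · rcases lt_or_ge n ℓ with h | h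
      · exact (hlt n h).le
      · simp [hk, h.not_gt, (h.trans n.le_succ).not_gt]
  intro n hn
  simp only [hk, hn, if_true]
  split_ifs with h
  · have hu1 : u < f (n + 1) := by
      refine lt_of_le_of_ne (hf (n + 1)).1 fun he => hne (n + 1) (by omega) h ?_
      exact hK.eq_of_mem huK (he ▸ hfK (n + 1))
    by_contra! hcon
    have hn0 : 0 < n := by
      by_contra! h0
      have : n = 0 := by omega
      subst this
      rw [hf0] at hcon
      linarith
    have hstep : i + ((n + 1 : ℕ) : ZMod ℓ) = i + n + 1 := by push_cast; ring
    have hlt : f (n + 1) < f n := by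
      refine lt_of_le_of_ne hcon fun he => ?_
      have h2 : (f n : Torus) ∈ K (i + n + 1) := by
        rw [← he, ← hstep]
        exact hfK (n + 1)
      have := eq_one_of_eq_add_one (hK.eq_of_mem (hfK n) h2)
      omega
    -- If the next lift came earlier, the clockwise path to it would pass through u + 1, placing a
    -- point of K i strictly between two consecutive stable components.
    refine hK.2 (i + n) i (u : Torus) huK ⟨?_, ?_, Or.inr ⟨f n, hfK n, f (n + 1), ?_, ?_⟩⟩
    · intro h'
      exact hne n hn0 hn (hK.eq_of_mem huK h')
    · intro h'
      rw [← hstep] at h'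
      exact hne (n + 1) (by omega) h (hK.eq_of_mem huK h')
    · rw [← hstep]
      exact hfK (n + 1)
    · rw [← coe_add_one (f (n + 1)), cwArc_coe (by linarith [(hf n).2]) (by linarith),
        ← coe_add_one u]
      exact ⟨u + 1, ⟨(hf n).2.le, by linarith⟩, rfl⟩
  · exact (hf n).2

end Labelling

/-! ### The potential S, its largest rise, and the inequality with V. -/

section Potential

variable {F : Torus → ℝ}

theorem intervalIntegrable_lift (hF : Continuous F) (a b : ℝ) :
    IntervalIntegrable (fun s : ℝ => F (s : Torus)) MeasureTheory.volume a b :=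
  (continuous_lift hF).intervalIntegrable a b

theorem continuous_pos (hF : Continuous F) : Continuous fun x => max (F x) 0 :=
  hF.max continuous_const

theorem continuous_negPart (hF : Continuous F) : Continuous fun x => |min (F x) 0| :=
  (hF.min continuous_const).abs

theorem S_sub_S (hF : Continuous F) (x y : ℝ) :
    S F y - S F x = ∫ s in x..y, F (s : Torus) :=
  intervalIntegral.integral_interval_sub_left (intervalIntegrable_lift hF 0 y)
    (intervalIntegrable_lift hF 0 x)

theorem continuous_S (hF : Continuous F) : Continuous (S F) :=
  intervalIntegral.continuous_primitive (fun a b => intervalIntegrable_lift hF a b) 0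

theorem S_add_one (hF : Continuous F) (y : ℝ) : S F (y + 1) = S F y + S F 1 := by
  have hp : Function.Periodic (fun s : ℝ => F (s : Torus)) 1 := fun s => by
    simp only [coe_add_one]
  have h := hp.intervalIntegral_add_eq y 0
  rw [← S_sub_S hF, ← S_sub_S hF] at h
  simp only [zero_add] at h
  have h0 : S F 0 = 0 := intervalIntegral.integral_same
  linarith

theorem integral_pos_nonneg {x y : ℝ} (hxy : x ≤ y) :
    0 ≤ ∫ s in x..y, max (F (s : Torus)) 0 :=
  intervalIntegral.integral_nonneg hxy fun _ _ => le_max_right _ _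

theorem integral_neg_nonneg {x y : ℝ} (hxy : x ≤ y) :
    0 ≤ ∫ s in x..y, |min (F (s : Torus)) 0| :=
  intervalIntegral.integral_nonneg hxy fun _ _ => abs_nonneg _

theorem S_sub_eq (hF : Continuous F) (x y : ℝ) :
    S F y - S F x = (∫ s in x..y, max (F (s : Torus)) 0) - ∫ s in x..y, |min (F (s : Torus)) 0| := by
  rw [S_sub_S hF, ← intervalIntegral.integral_sub (intervalIntegrable_lift (continuous_pos hF) x y)
    (intervalIntegrable_lift (continuous_negPart hF) x y)]
  congr 1
  ext s
  rw [abs_of_nonpos (min_le_right _ _)]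
  linarith [max_add_min (F (s : Torus)) 0]

theorem integral_pos_of_nonpos {x y : ℝ} (hxy : x ≤ y) (h : ∀ s ∈ Icc x y, F (s : Torus) ≤ 0) :
    ∫ s in x..y, max (F (s : Torus)) 0 = 0 := by
  rw [intervalIntegral.integral_congr (g := fun _ => 0) fun s hs => ?_]
  · simp
  · rw [uIcc_of_le hxy] at hs
    exact max_eq_right (h s hs)

theorem integral_neg_of_nonneg {x y : ℝ} (hxy : x ≤ y) (h : ∀ s ∈ Icc x y, 0 ≤ F (s : Torus)) :
    ∫ s in x..y, |min (F (s : Torus)) 0| = 0 := by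
  rw [intervalIntegral.integral_congr (g := fun _ => 0) fun s hs => ?_]
  · simp
  · rw [uIcc_of_le hxy] at hs
    simp only [min_eq_right (h s hs), abs_zero]

theorem integral_pos_of_nonneg (hF : Continuous F) {x y : ℝ} (hxy : x ≤ y)
    (h : ∀ s ∈ Icc x y, 0 ≤ F (s : Torus)) :
    ∫ s in x..y, max (F (s : Torus)) 0 = S F y - S F x := by
  rw [S_sub_eq hF, integral_neg_of_nonneg hxy h, sub_zero]

theorem integral_neg_of_nonpos (hF : Continuous F) {x y : ℝ} (hxy : x ≤ y)
    (h : ∀ s ∈ Icc x y, F (s : Torus) ≤ 0) :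
    ∫ s in x..y, |min (F (s : Torus)) 0| = S F x - S F y := by
  have := S_sub_eq hF x y
  rw [integral_pos_of_nonpos hxy h] at this
  linarith

theorem S_mono_of_nonneg (hF : Continuous F) {x y : ℝ} (hxy : x ≤ y)
    (h : ∀ s ∈ Icc x y, 0 ≤ F (s : Torus)) : S F x ≤ S F y := by
  linarith [integral_pos_of_nonneg hF hxy h, integral_pos_nonneg (F := F) hxy]

theorem S_anti_of_nonpos (hF : Continuous F) {x y : ℝ} (hxy : x ≤ y)
    (h : ∀ s ∈ Icc x y, F (s : Torus) ≤ 0) : S F y ≤ S F x := by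
  linarith [integral_neg_of_nonpos hF hxy h, integral_neg_nonneg (F := F) hxy]

theorem integral_lift_add {h : Torus → ℝ} (hh : Continuous h) (x y z : ℝ) :
    (∫ s in x..y, h (s : Torus)) + ∫ s in y..z, h (s : Torus) = ∫ s in x..z, h (s : Torus) :=
  intervalIntegral.integral_add_adjacent_intervals (intervalIntegrable_lift hh x y)
    (intervalIntegrable_lift hh y z)

theorem S_le_windowMax (hF : Continuous F) {u y : ℝ} (hy : y ∈ Icc u (u + 1)) :
    S F y ≤ windowMax F u :=
  le_csSup (isCompact_Icc.image (continuous_S hF)).bddAbove ⟨y, hy, rfl⟩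

theorem exists_S_eq_windowMax (hF : Continuous F) (u : ℝ) :
    ∃ y ∈ Icc u (u + 1), S F y = windowMax F u := by
  obtain ⟨y, hy, h⟩ := (isCompact_Icc.image (continuous_S hF)).sSup_mem
    ((nonempty_Icc.2 (by linarith : u ≤ u + 1)).image (S F))
  exact ⟨y, hy, h⟩

theorem windowMax_le {u B : ℝ} (h : ∀ y ∈ Icc u (u + 1), S F y ≤ B) : windowMax F u ≤ B := by
  refine csSup_le ((nonempty_Icc.2 (by linarith)).image _) ?_
  rintro _ ⟨y, hy, rfl⟩
  exact h y hy

theorem windowRise_eq (hF : Continuous F) (u : ℝ) : windowRise F u = windowMax F u - S F u := by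
  obtain ⟨y, hy, h⟩ := exists_S_eq_windowMax hF u
  refine IsGreatest.csSup_eq ⟨⟨y, hy, by simp only [h]⟩, ?_⟩
  rintro _ ⟨z, hz, rfl⟩
  linarith [S_le_windowMax hF hz]

/-- S itself need not be periodic, but its increments from v depend only on the projection of v.
Thus the largest rise is a function on the circle. -/
theorem windowRise_congr (hF : Continuous F) {u u' : ℝ} (h : (u : Torus) = (u' : Torus)) :
    windowRise F u = windowRise F u' := by
  have key (v : ℝ) : (fun y => S F y - S F v) '' Icc v (v + 1) =
      (fun t : ℝ => ∫ s in (0 : ℝ)..t, F ((v : Torus) + (s : Torus))) '' Icc 0 1 := by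
    have hS (t : ℝ) : ∫ s in (0 : ℝ)..t, F ((v : Torus) + (s : Torus)) = S F (v + t) - S F v := by
      rw [S_sub_S hF]
      simpa using intervalIntegral.integral_comp_add_left (a := 0) (b := t)
        (fun r : ℝ => F (r : Torus)) v
    simp only [hS]
    ext r
    constructor
    · rintro ⟨y, hy, rfl⟩
      exact ⟨y - v, ⟨by linarith [hy.1], by linarith [hy.2]⟩, by simp⟩
    · rintro ⟨t, ht, rfl⟩
      exact ⟨v + t, ⟨by linarith [ht.1], by linarith [ht.2]⟩, by simp⟩
  rw [windowRise, windowRise, key, key, h]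

/-- If the maximiser lies beyond x, it is in the window of x, and the rise up to x is paid by F₊. If
it lies before x, the whole rise is paid by F₊. -/
theorem windowRise_le_Vplus (hF : Continuous F) (y x : ℝ) :
    windowRise F y ≤ Vplus F y x + windowRise F x := by
  obtain ⟨x', hx', hx⟩ := exists_lift_Ico y (x : Torus)
  rw [← windowRise_congr hF hx, ← hx, Vplus, cwIntegral_coe _ hx'.1 hx'.2, windowRise_eq hF y,
    windowRise_eq hF x']
  obtain ⟨z, hz, hzM⟩ := exists_S_eq_windowMax hF y
  rw [← hzM]
  rcases le_total x' z with h | h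
  · have h1 := S_le_windowMax hF (u := x') (y := z) ⟨h, by linarith [hz.2, hx'.1]⟩
    have h2 := S_sub_eq hF y x'
    have h3 := integral_neg_nonneg (F := F) hx'.1
    linarith
  · have h1 := S_le_windowMax hF (u := x') (y := x') ⟨le_rfl, by linarith⟩
    have h2 := S_sub_eq hF y z
    have h3 := integral_neg_nonneg (F := F) hz.1
    have h4 := integral_pos_nonneg (F := F) h
    have h5 := integral_lift_add (continuous_pos hF) y z x'
    linarith

theorem windowRise_le_Vminus (hF : Continuous F) (y x : ℝ) :
    windowRise F y ≤ Vminus F y x + windowRise F x := by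
  obtain ⟨y', hy', hy⟩ := exists_lift_Ico x (y : Torus)
  rw [← windowRise_congr hF hy, ← hy, Vminus, cwIntegral_coe _ hy'.1 hy'.2, windowRise_eq hF y',
    windowRise_eq hF x]
  obtain ⟨z, hz, hzM⟩ := exists_S_eq_windowMax hF y'
  rw [← hzM]
  rcases le_total z (x + 1) with h | h
  · have h1 := S_le_windowMax hF (u := x) (y := z) ⟨by linarith [hz.1, hy'.1], h⟩
    have h2 := S_sub_eq hF x y'
    have h3 := integral_pos_nonneg (F := F) hy'.1
    linarith
  -- The maximiser z has left the window of x. Since S(z) − S(x + 1) = S(z − 1) − S(x), it remains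
  -- to pay for the drop from z − 1 to y', which F₋ does.
  · have h1 := S_le_windowMax hF (u := x) (y := x + 1) ⟨by linarith, le_rfl⟩
    have hx1 := S_add_one hF x
    have hz1 := S_add_one hF (z - 1)
    rw [sub_add_cancel] at hz1
    have hzy : z - 1 ≤ y' := by linarith [hz.2]
    have hxz : x ≤ z - 1 := by linarith
    have h2 := S_sub_eq hF (z - 1) y'
    have h3 := integral_pos_nonneg (F := F) hzy
    have h4 := integral_neg_nonneg (F := F) hxz
    have h5 := integral_lift_add (continuous_negPart hF) x (z - 1) y'
    linarith

theorem windowRise_le_V (hF : Continuous F) (y x : ℝ) :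
    windowRise F y ≤ V F y x + windowRise F x := by
  rw [V, ← min_add_add_right]
  exact le_min (windowRise_le_Vplus hF y x) (windowRise_le_Vminus hF y x)

theorem setSet_V (C D : Set Torus) : setSet (V F) C D = V F (pt C) (pt D) := by
  rw [setSet]
  split_ifs with h
  · simp [h, V, Vplus, Vminus, cwIntegral_self]
  · rfl

theorem setSet_Vplus (C D : Set Torus) : setSet (Vplus F) C D = Vplus F (pt C) (pt D) := by
  rw [setSet]
  split_ifs with h
  · simp [h, Vplus, cwIntegral_self]
  · rfl

theorem setSet_Vminus (C D : Set Torus) : setSet (Vminus F) C D = Vminus F (pt C) (pt D) := by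
  rw [setSet]
  split_ifs with h
  · simp [h, Vminus, cwIntegral_self]
  · rfl

theorem integral_eq_zero_of_Icc {h : Torus → ℝ} {a b x y : ℝ}
    (h0 : ∀ s ∈ Icc a b, h (s : Torus) = 0) (hx : x ∈ Icc a b) (hy : y ∈ Icc a b) :
    ∫ s in x..y, h (s : Torus) = 0 := by
  rw [intervalIntegral.integral_congr (g := fun _ => 0) fun s hs => h0 s ?_]
  · simp
  · exact (uIcc_subset_Icc hx hy) hs

/-- Moving inside an interval of zeros costs nothing in either direction, so the one-sided bounds
compare the rises directly. -/
theorem IsStable.windowRise_le (hF : Continuous F) {C : Set Torus} (hC : IsStable F C) {u u' : ℝ}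
    (hu : (u : Torus) ∈ C) (hu' : (u' : Torus) ∈ C) : windowRise F u ≤ windowRise F u' := by
  obtain ⟨a, b, -, hab, hlt, hCI, hz, -⟩ := hC.exists_lift hu
  rw [hCI] at hu'
  obtain ⟨r, hr, hru⟩ := hu'
  rw [← windowRise_congr hF hru]
  rcases le_total u r with h | h
  · have := windowRise_le_Vplus hF u r
    rwa [Vplus, cwIntegral_coe _ h (by linarith [hr.2, hab.1]),
      integral_eq_zero_of_Icc (h := fun s => max (F s) 0) (fun s hs => by simp [hz s hs]) hab hr,
      zero_add] at this
  · have := windowRise_le_Vminus hF u r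
    rwa [Vminus, cwIntegral_coe _ h (by linarith [hr.1, hab.2]),
      integral_eq_zero_of_Icc (h := fun s => |min (F s) 0|) (fun s hs => by simp [hz s hs]) hr hab,
      zero_add] at this

theorem IsStable.windowRise_eq (hF : Continuous F) {C : Set Torus} (hC : IsStable F C) {u u' : ℝ}
    (hu : (u : Torus) ∈ C) (hu' : (u' : Torus) ∈ C) : windowRise F u = windowRise F u' :=
  le_antisymm (hC.windowRise_le hF hu hu') (hC.windowRise_le hF hu' hu)

/-- The value of `f(C, y)` does not depend on the point of `C` from which it is computed. -/
theorem IsStable.cwIntegral_pt_left {C : Set Torus} (hC : IsStable F C) {h : Torus → ℝ}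
    (hh : Continuous h) (h0 : ∀ x, F x = 0 → h x = 0) {u v : ℝ} (hu : (u : Torus) ∈ C)
    (hv : v ∈ Ioc u (u + 1)) (hvC : (v : Torus) ∉ C) :
    cwIntegral h (pt C) v = ∫ s in u..v, h (s : Torus) := by
  obtain ⟨a, b, -, hab, hlt, hCI, hz, -⟩ := hC.exists_lift hu
  have hp := pt_mem ⟨_, hu⟩
  rw [hCI] at hp
  obtain ⟨r, hr, hru⟩ := hp
  have hbv : b < v := by
    by_contra! hcon
    exact hvC (hCI ▸ ⟨v, ⟨hab.1.trans hv.1.le, hcon⟩, rfl⟩)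
  have hva : v < a + 1 := by
    by_contra! hcon
    refine hvC (hCI ▸ coe_mem_image.2 ⟨-1, ?_, ?_⟩)
    · push_cast; linarith
    · push_cast; linarith [hv.2, hab.2]
  rw [hCI, ← hru, cwIntegral_coe _ (by linarith [hr.2]) (by linarith [hr.1]),
    ← integral_lift_add hh r u v,
    integral_eq_zero_of_Icc (fun s hs => h0 _ (hz s hs)) hr hab, zero_add]

theorem IsStable.cwIntegral_pt_right {C : Set Torus} (hC : IsStable F C) {h : Torus → ℝ}
    (hh : Continuous h) (h0 : ∀ x, F x = 0 → h x = 0) {v w : ℝ} (hw : (w : Torus) ∈ C)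
    (hvw : v < w) (hwv : w ≤ v + 1) (hvC : (v : Torus) ∉ C) :
    cwIntegral h v (pt C) = ∫ s in v..w, h (s : Torus) := by
  obtain ⟨a, b, -, hab, hlt, hCI, hz, -⟩ := hC.exists_lift hw
  have hp := pt_mem ⟨_, hw⟩
  rw [hCI] at hp
  obtain ⟨r, hr, hru⟩ := hp
  have hva : v < a := by
    by_contra! hcon
    exact hvC (hCI ▸ ⟨v, ⟨hcon, hvw.le.trans hab.2⟩, rfl⟩)
  have hbv : b < v + 1 := by
    by_contra! hcon
    refine hvC (hCI ▸ coe_mem_image.2 ⟨1, ?_, ?_⟩)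
    · push_cast; linarith [hab.1]
    · push_cast; linarith
  rw [hCI, ← hru, cwIntegral_coe _ (by linarith [hr.1]) (by linarith [hr.2]),
    ← integral_lift_add hh v w r,
    integral_eq_zero_of_Icc (fun s hs => h0 _ (hz s hs)) hab hr, add_zero]

end Potential

/-! ### Combinatorics of rooted trees on a cycle cut at the root. -/

section Trees

variable {ℓ : ℕ}

theorem val_add_natCast_sub (i : ZMod ℓ) {n : ℕ} (hn : n < ℓ) : (i + (n : ZMod ℓ) - i).val = n := by
  rw [add_sub_cancel_left, ZMod.val_natCast_of_lt hn]

theorem val_sub_pos_iff {i m : ZMod ℓ} : 0 < (m - i).val ↔ m ≠ i := by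
  rw [Nat.pos_iff_ne_zero, Ne, ZMod.val_eq_zero, sub_eq_zero]

variable [NeZero ℓ]

theorem add_natCast_val_sub (i m : ZMod ℓ) : i + ((m - i).val : ZMod ℓ) = m := by
  rw [ZMod.natCast_zmod_val]
  ring

theorem mem_specialGraph {i J m n : ZMod ℓ} : (m, n) ∈ specialGraph i J ↔
    (m ∈ acwStarts i J ∧ n = m - 1) ∨ (m ∈ cwStarts i J ∧ n = m + 1) := by
  simp only [specialGraph, Finset.mem_union, Finset.mem_image, Prod.mk.injEq]
  constructor
  · rintro (⟨a, ha, rfl, rfl⟩ | ⟨a, ha, rfl, rfl⟩)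
    · exact Or.inl ⟨ha, rfl⟩
    · exact Or.inr ⟨ha, rfl⟩
  · rintro (⟨ha, rfl⟩ | ⟨ha, rfl⟩)
    · exact Or.inl ⟨m, ha, rfl, rfl⟩
    · exact Or.inr ⟨m, ha, rfl, rfl⟩

theorem mem_acwStarts {i J m : ZMod ℓ} :
    m ∈ acwStarts i J ↔ 0 < (m - i).val ∧ (m - i).val ≤ (J - i).val := by
  simp [acwStarts]

theorem mem_cwStarts {i J m : ZMod ℓ} : m ∈ cwStarts i J ↔ (J - i).val < (m - i).val := by
  simp [cwStarts]

theorem specialGraph_mem_rootedTrees (i J : ZMod ℓ) : specialGraph i J ∈ rootedTrees i := by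
  have hJ : (J - i).val < ℓ := ZMod.val_lt _
  refine ⟨?_, ?_, ?_⟩
  · intro m hm
    have hm0 := val_sub_pos_iff.2 hm
    by_cases h : (m - i).val ≤ (J - i).val
    · refine ⟨m - 1, mem_specialGraph.2 (Or.inl ⟨mem_acwStarts.2 ⟨hm0, h⟩, rfl⟩), fun n hn => ?_⟩
      rcases mem_specialGraph.1 hn with ⟨-, h'⟩ | ⟨h', -⟩
      · exact h'
      · exact absurd (mem_cwStarts.1 h') (by omega)
    · refine ⟨m + 1, mem_specialGraph.2 (Or.inr ⟨mem_cwStarts.2 (by omega), rfl⟩), fun n hn => ?_⟩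
      rcases mem_specialGraph.1 hn with ⟨h', -⟩ | ⟨-, h'⟩
      · exact absurd (mem_acwStarts.1 h').2 h
      · exact h'
  · have hdown : ∀ n : ℕ, n + 1 ≤ (J - i).val →
        Relation.TransGen (fun m n => (m, n) ∈ specialGraph i J) (i + (n + 1 : ℕ)) i := by
      intro n
      induction n with
      | zero =>
        intro h
        refine Relation.TransGen.single (mem_specialGraph.2 (Or.inl ⟨mem_acwStarts.2 ?_, by simp⟩))
        rw [val_add_natCast_sub i (by omega)]
        omega
      | succ n ih =>
        intro h
        refine Relation.TransGen.head (mem_specialGraph.2 (Or.inl ⟨mem_acwStarts.2 ?_, ?_⟩))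
          (ih (by omega))
        · rw [val_add_natCast_sub i (by omega)]
          omega
        · push_cast
          ring
    -- Induction on the number d of arrows preceding the last one, which goes from position ℓ − 1 to
    -- the root.
    have hup : ∀ d n : ℕ, n + d + 1 = ℓ → (J - i).val < n →
        Relation.TransGen (fun m n => (m, n) ∈ specialGraph i J) (i + (n : ℕ)) i := by
      intro d
      induction d with
      | zero =>
        intro n hn h
        refine Relation.TransGen.single (mem_specialGraph.2 (Or.inr ⟨mem_cwStarts.2 ?_, ?_⟩))
        · rw [val_add_natCast_sub i (by omega)]
          omega
        · have : ((n + 1 : ℕ) : ZMod ℓ) = 0 := by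
            rw [show n + 1 = ℓ by omega, ZMod.natCast_self]
          push_cast at this
          rw [add_assoc, this, add_zero]
      | succ d ih =>
        intro n hn h
        refine Relation.TransGen.head (mem_specialGraph.2 (Or.inr ⟨mem_cwStarts.2 ?_, ?_⟩))
          (ih (n + 1) (by omega) (by omega))
        · rw [val_add_natCast_sub i (by omega)]
          omega
        · push_cast
          ring
    intro m hm
    have hm0 := val_sub_pos_iff.2 hm
    have hml : (m - i).val < ℓ := ZMod.val_lt _
    rw [← add_natCast_val_sub i m]
    by_cases h : (m - i).val ≤ (J - i).val
    · obtain ⟨n, hn⟩ := Nat.exists_eq_succ_of_ne_zero hm0.ne'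
      rw [hn] at h ⊢
      exact hdown n h
    · exact hup (ℓ - 1 - (m - i).val) _ (by omega) (by omega)
  · intro n hn
    rcases mem_specialGraph.1 hn with ⟨h, -⟩ | ⟨h, -⟩
    · simpa using (mem_acwStarts.1 h).1
    · simpa using mem_cwStarts.1 h

theorem sum_specialGraph (i J : ZMod ℓ) (f : ZMod ℓ → ZMod ℓ → ℝ) :
    ∑ p ∈ specialGraph i J, f p.1 p.2 =
      ∑ m ∈ acwStarts i J, f m (m - 1) + ∑ m ∈ cwStarts i J, f m (m + 1) := by
  rw [specialGraph, Finset.sum_union, Finset.sum_image, Finset.sum_image]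
  · intro a _ b _ h
    exact (Prod.ext_iff.1 h).1
  · intro a _ b _ h
    exact (Prod.ext_iff.1 h).1
  · rw [Finset.disjoint_left]
    intro p hp hp'
    obtain ⟨a, ha, rfl⟩ := Finset.mem_image.1 hp
    obtain ⟨b, hb, hab⟩ := Finset.mem_image.1 hp'
    obtain rfl : b = a := (Prod.ext_iff.1 hab).1
    have h1 := (mem_acwStarts.1 ha).2
    have h2 := mem_cwStarts.1 hb
    omega

/-- Edge e joins positions e and e + 1, so an anticlockwise arrow is charged to the position below
its start; a clockwise arrow is charged to its start. Edge (J − i).val is the only one the special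
graph leaves out. -/
theorem sum_acwStarts (i J : ZMod ℓ) (f : ℕ → ℝ) :
    ∑ m ∈ acwStarts i J, f ((m - i).val - 1) = ∑ n ∈ Finset.range (J - i).val, f n := by
  have hJ : (J - i).val < ℓ := ZMod.val_lt _
  refine Finset.sum_nbij' (fun m => (m - i).val - 1) (fun n => i + ((n + 1 : ℕ) : ZMod ℓ)) ?_ ?_ ?_ ?_
    fun _ _ => rfl
  · intro m hm
    have := mem_acwStarts.1 hm
    rw [Finset.mem_range]
    omega
  · intro n hn
    rw [Finset.mem_range] at hn
    rw [mem_acwStarts, val_add_natCast_sub i (by omega)]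
    omega
  · intro m hm
    have := mem_acwStarts.1 hm
    rw [Nat.sub_add_cancel this.1, add_natCast_val_sub]
  · intro n hn
    rw [Finset.mem_range] at hn
    rw [val_add_natCast_sub i (by omega), Nat.add_sub_cancel]

theorem sum_cwStarts (i J : ZMod ℓ) (f : ℕ → ℝ) :
    ∑ m ∈ cwStarts i J, f (m - i).val = ∑ n ∈ Finset.Ico ((J - i).val + 1) ℓ, f n := by
  refine Finset.sum_nbij' (fun m => (m - i).val) (fun n => i + (n : ZMod ℓ)) ?_ ?_ ?_ ?_
    fun _ _ => rfl
  · intro m hm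
    have := mem_cwStarts.1 hm
    rw [Finset.mem_Ico]
    exact ⟨by omega, ZMod.val_lt _⟩
  · intro n hn
    rw [Finset.mem_Ico] at hn
    rw [mem_cwStarts, val_add_natCast_sub i (by omega)]
    omega
  · intro m _
    exact add_natCast_val_sub i m
  · intro n hn
    rw [Finset.mem_Ico] at hn
    exact val_add_natCast_sub i hn.2

/-- Edges crossed by the clockwise path between the positions `m` and `n`, up to the root. -/
def cwEdges (ℓ m n : ℕ) : Finset ℕ := Finset.Ico m (if m ≤ n then n else ℓ)

/-- Edges crossed by the anticlockwise path between the positions `m` and `n`, up to the root. -/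
def acwEdges (m n : ℕ) : Finset ℕ := Finset.Ico (if n ≤ m then n else 0) m

theorem sum_biUnion_le_sum {ι κ : Type*} [DecidableEq κ] (s : Finset ι) (t : ι → Finset κ)
    (f : κ → ℝ) (hf : ∀ x, 0 ≤ f x) : ∑ x ∈ s.biUnion t, f x ≤ ∑ a ∈ s, ∑ x ∈ t a, f x := by
  classical
  induction s using Finset.induction_on with
  | empty => simp
  | insert a s ha ih =>
    rw [Finset.biUnion_insert, Finset.sum_insert ha]
    have h := Finset.sum_union_inter (s₁ := t a) (s₂ := s.biUnion t) (f := f)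
    have h' : 0 ≤ ∑ x ∈ t a ∩ s.biUnion t, f x := Finset.sum_nonneg fun x _ => hf x
    linarith

/-- If every arrow costs at least the clockwise or the anticlockwise edges it crosses, then a tree
costs at least one of the special graphs. -/
theorem exists_le_sum_of_mem_rootedTrees {i : ZMod ℓ} {g : Finset (ZMod ℓ × ZMod ℓ)}
    (hg : g ∈ rootedTrees i) (p q : ℕ → ℝ) (hp : ∀ n, 0 ≤ p n) (hq : ∀ n, 0 ≤ q n)
    (f : ZMod ℓ × ZMod ℓ → ℝ)
    (hf : ∀ a, ∑ e ∈ cwEdges ℓ (a.1 - i).val (a.2 - i).val, p e ≤ f a ∨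
      ∑ e ∈ acwEdges (a.1 - i).val (a.2 - i).val, q e ≤ f a) :
    ∃ j < ℓ, ∑ n ∈ Finset.range j, q n + ∑ n ∈ Finset.Ico (j + 1) ℓ, p n ≤ ∑ a ∈ g, f a := by
  classical
  have hℓ : 0 < ℓ := Nat.pos_of_ne_zero (NeZero.ne ℓ)
  set gc := g.filter fun a => ∑ e ∈ cwEdges ℓ (a.1 - i).val (a.2 - i).val, p e ≤ f a
  set ga := g.filter fun a => ¬ ∑ e ∈ cwEdges ℓ (a.1 - i).val (a.2 - i).val, p e ≤ f a
  set Q := gc.biUnion fun a => cwEdges ℓ (a.1 - i).val (a.2 - i).val with hQ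
  set P := ga.biUnion fun a => acwEdges (a.1 - i).val (a.2 - i).val with hP
  have hsum : ∑ e ∈ P, q e + ∑ e ∈ Q, p e ≤ ∑ a ∈ g, f a := by
    rw [← Finset.sum_filter_add_sum_filter_not g
      (fun a => ∑ e ∈ cwEdges ℓ (a.1 - i).val (a.2 - i).val, p e ≤ f a), add_comm]
    refine add_le_add ((sum_biUnion_le_sum _ _ _ hp).trans (Finset.sum_le_sum fun a ha => ?_))
      ((sum_biUnion_le_sum _ _ _ hq).trans (Finset.sum_le_sum fun a ha => ?_))
    · exact (Finset.mem_filter.1 ha).2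
    · exact (hf a).resolve_left (Finset.mem_filter.1 ha).2
  suffices h : ∃ j < ℓ, Finset.range j ⊆ P ∧ Finset.Ico (j + 1) ℓ ⊆ Q by
    obtain ⟨j, hj, h1, h2⟩ := h
    exact ⟨j, hj, (add_le_add (Finset.sum_le_sum_of_subset_of_nonneg h1 fun e _ _ => hq e)
      (Finset.sum_le_sum_of_subset_of_nonneg h2 fun e _ _ => hp e)).trans hsum⟩
  -- If every edge except possibly the last is crossed anticlockwise, j = ℓ − 1 works and no
  -- clockwise edge is required.
  by_cases hall : Finset.range (ℓ - 1) ⊆ P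
  · exact ⟨ℓ - 1, by omega, hall, by simp [Nat.sub_add_cancel hℓ]⟩
  have hex : ∃ j, j < ℓ - 1 ∧ j ∉ P := by
    obtain ⟨j, hj, hjP⟩ := Finset.not_subset.1 hall
    exact ⟨j, Finset.mem_range.1 hj, hjP⟩
  obtain ⟨hjl, hjP⟩ := Nat.find_spec hex
  have hmin : ∀ e < Nat.find hex, e ∈ P := fun e he => by
    have h := Nat.find_min hex he
    by_contra hcon
    exact h ⟨by omega, hcon⟩
  -- The first edge not crossed anticlockwise. Any later edge e must then be crossed clockwise.
  set j := Nat.find hex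
  refine ⟨j, by omega, fun e he => hmin e (Finset.mem_range.1 he), fun e he => ?_⟩
  rw [Finset.mem_Ico] at he
  by_contra heQ
  have hpos : (i + (e : ZMod ℓ) - i).val = e := val_add_natCast_sub i he.2
  -- Otherwise the positions j + 1, …, e form a trap: clockwise arrows cannot pass e and
  -- anticlockwise ones cannot pass j, so the vertex at e never reaches the root.
  have hstep : ∀ m n, (m, n) ∈ g → j < (m - i).val ∧ (m - i).val ≤ e →
      j < (n - i).val ∧ (n - i).val ≤ e := by
    intro m n hmn hm
    by_cases hc : (m, n) ∈ gc
    · have : e ∉ cwEdges ℓ (m - i).val (n - i).val := fun h =>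
        heQ (Finset.mem_biUnion.2 ⟨_, hc, h⟩)
      rw [cwEdges, Finset.mem_Ico] at this
      split_ifs at this <;> omega
    · have ha : (m, n) ∈ ga := by
        refine Finset.mem_filter.2 ⟨hmn, fun h => hc (Finset.mem_filter.2 ⟨hmn, h⟩)⟩
      have : j ∉ acwEdges (m - i).val (n - i).val := fun h =>
        hjP (Finset.mem_biUnion.2 ⟨_, ha, h⟩)
      rw [acwEdges, Finset.mem_Ico] at this
      split_ifs at this <;> omega
  have hreach := hg.2.1 (i + (e : ZMod ℓ)) (val_sub_pos_iff.1 (by omega))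
  have hinv : ∀ n, Relation.TransGen (fun m n => (m, n) ∈ g) (i + (e : ZMod ℓ)) n →
      j < (n - i).val ∧ (n - i).val ≤ e := by
    intro n hn
    induction hn with
    | single h => exact hstep _ _ h (by omega)
    | tail _ h ih => exact hstep _ _ h ih
  have := (hinv i hreach).1
  simp at this

end Trees

/-- Increasing lifts `k n` of the chosen points of the stable components, starting from `u`, and
lifts `α n` of points of the totally unstable components between them. -/
structure LiftedChain (F : Torus → ℝ) {ℓ : ℕ} (K : ZMod ℓ → Set Torus) (i : ZMod ℓ) (u : ℝ)
    (k α : ℕ → ℝ) : Prop where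
  zero : k 0 = u
  last : k ℓ = u + 1
  mono : Monotone k
  coe : ∀ n ≤ ℓ, (k n : Torus) = pt (K (i + n))
  left : ∀ n < ℓ, k n < α n
  right : ∀ n < ℓ, α n < k (n + 1)
  coe_top : ∀ n < ℓ, (α n : Torus) = pt (unstableBetween F K (i + n))
  nonneg : ∀ n < ℓ, ∀ s ∈ Icc (k n) (α n), 0 ≤ F (s : Torus)
  nonpos : ∀ n < ℓ, ∀ s ∈ Icc (α n) (k (n + 1)), F (s : Torus) ≤ 0

/-! ### Costs of trees in terms of the heights of the peaks. -/

section Chain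

variable {F : Torus → ℝ} {ℓ : ℕ} {K : ZMod ℓ → Set Torus} {i : ZMod ℓ} {u : ℝ} {k α : ℕ → ℝ}

theorem IsLabelling.exists_liftedChain [NeZero ℓ] (hF : Continuous F)
    (hfin : {C : Set Torus | IsZeroComponent F C}.Finite) (hK : IsLabelling F K)
    (hu : (u : Torus) = pt (K i)) : ∃ k α : ℕ → ℝ, LiftedChain F K i u k α := by
  obtain ⟨k, h0, hl, hcoe, hlt, hmono⟩ := hK.exists_chain hu
  have hα : ∀ n : ℕ, ∃ a : ℝ, n < ℓ → k n < a ∧ a < k (n + 1) ∧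
      (a : Torus) = pt (unstableBetween F K (i + n)) ∧ (∀ s ∈ Icc (k n) a, 0 ≤ F (s : Torus)) ∧
      (∀ s ∈ Icc a (k (n + 1)), F (s : Torus) ≤ 0) := by
    intro n
    by_cases hn : n < ℓ
    · have h1 : k (n + 1) ≤ k n + 1 := by
        have h2 := hmono (show n + 1 ≤ ℓ by omega)
        have h3 := hmono (Nat.zero_le n)
        linarith
      have h2 : i + ((n + 1 : ℕ) : ZMod ℓ) = i + n + 1 := by push_cast; ring
      obtain ⟨c, d, huc, hcd, hdw, hA, hpos, hneg⟩ := hK.exists_gap hF hfin (i := i + n) (u := k n)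
        (w := k (n + 1)) (hcoe n hn.le ▸ hK.pt_mem _)
        (by rw [hcoe (n + 1) hn, h2]; exact hK.pt_mem _) ⟨hlt n hn, h1⟩ (fun hℓ => by
          subst hℓ
          rw [hcoe n hn.le, hcoe (n + 1) hn]
          exact congrArg (fun j => pt (K j)) (Subsingleton.elim _ _))
      have hp : pt (unstableBetween F K (i + n)) ∈ unstableBetween F K (i + n) :=
        FW.pt_mem ⟨(c : Torus), hA ▸ ⟨c, ⟨le_rfl, hcd⟩, rfl⟩⟩
      rw [hA] at hp
      obtain ⟨a, ha, hap⟩ := hp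
      rw [← hA] at hap
      exact ⟨a, fun _ => ⟨by linarith [ha.1], by linarith [ha.2], hap,
        fun s hs => hpos s ⟨hs.1, hs.2.trans ha.2⟩, fun s hs => hneg s ⟨ha.1.trans hs.1, hs.2⟩⟩⟩
    · exact ⟨0, fun h => absurd h hn⟩
  choose α hα using hα
  exact ⟨k, α, h0, hl, hmono, hcoe, fun n hn => (hα n hn).1, fun n hn => (hα n hn).2.1,
    fun n hn => (hα n hn).2.2.1, fun n hn => (hα n hn).2.2.2.1, fun n hn => (hα n hn).2.2.2.2⟩

theorem LiftedChain.le (hc : LiftedChain F K i u k α) (n : ℕ) : u ≤ k n :=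
  hc.zero ▸ hc.mono (Nat.zero_le n)

theorem LiftedChain.le_add_one (hc : LiftedChain F K i u k α) {n : ℕ} (hn : n ≤ ℓ) :
    k n ≤ u + 1 := hc.last ▸ hc.mono hn

theorem LiftedChain.lt (hc : LiftedChain F K i u k α) {m n : ℕ} (hmn : m < n) (hn : n ≤ ℓ) :
    k m < k n :=
  ((hc.left m (by omega)).trans (hc.right m (by omega))).trans_le (hc.mono hmn)

theorem LiftedChain.exists_mem (hc : LiftedChain F K i u k α) {y : ℝ} (hy : y ∈ Icc u (u + 1))
    (hℓ : 0 < ℓ) : ∃ n < ℓ, k n ≤ y ∧ y ≤ k (n + 1) := by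
  by_contra! h
  have : ∀ n < ℓ, k (n + 1) < y := by
    intro n
    induction n with
    | zero => exact fun h0 => h 0 h0 (hc.zero ▸ hy.1)
    | succ n ih => exact fun h0 => h (n + 1) h0 (ih (by omega)).le
  have h1 := this (ℓ - 1) (by omega)
  rw [Nat.sub_add_cancel hℓ, hc.last] at h1
  linarith [hy.2]

/-- S increases up to α n and decreases after it, so only the peaks compete for the maximum over the
window. -/
theorem LiftedChain.S_le (hc : LiftedChain F K i u k α) (hF : Continuous F) {n : ℕ} (hn : n < ℓ)
    {y : ℝ} (h1 : k n ≤ y) (h2 : y ≤ k (n + 1)) : S F y ≤ S F (α n) := by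
  rcases le_total y (α n) with h | h
  · exact S_mono_of_nonneg hF h fun s hs => hc.nonneg n hn s ⟨h1.trans hs.1, hs.2⟩
  · exact S_anti_of_nonpos hF h fun s hs => hc.nonpos n hn s ⟨hs.1, hs.2.trans h2⟩

theorem LiftedChain.top_mem (hc : LiftedChain F K i u k α) {n : ℕ} (hn : n < ℓ) :
    α n ∈ Ioo u (u + 1) :=
  ⟨(hc.le n).trans_lt (hc.left n hn), (hc.right n hn).trans_le (hc.le_add_one hn)⟩

theorem LiftedChain.le_windowRise (hc : LiftedChain F K i u k α) (hF : Continuous F) {n : ℕ}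
    (hn : n < ℓ) : S F (α n) - S F u ≤ windowRise F u := by
  rw [windowRise_eq hF]
  linarith [S_le_windowMax hF (Ioo_subset_Icc_self (hc.top_mem hn))]

theorem LiftedChain.exists_eq_windowRise [NeZero ℓ] (hc : LiftedChain F K i u k α)
    (hF : Continuous F) : ∃ n < ℓ, S F (α n) - S F u = windowRise F u := by
  obtain ⟨y, hy, hyM⟩ := exists_S_eq_windowMax hF u
  obtain ⟨n, hn, h1, h2⟩ := hc.exists_mem hy (Nat.pos_of_ne_zero (NeZero.ne ℓ))
  refine ⟨n, hn, le_antisymm (hc.le_windowRise hF hn) ?_⟩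
  rw [windowRise_eq hF]
  linarith [hc.S_le hF hn h1 h2]

theorem LiftedChain.sum_Ico (k : ℕ → ℝ) {h : Torus → ℝ} (hh : Continuous h) {m n : ℕ}
    (hmn : m ≤ n) : ∑ e ∈ Finset.Ico m n, ∫ s in k e..k (e + 1), h (s : Torus) =
      ∫ s in k m..k n, h (s : Torus) :=
  intervalIntegral.sum_integral_adjacent_intervals_Ico hmn fun _ _ => intervalIntegrable_lift hh _ _

theorem integral_lift_shift (h : Torus → ℝ) (x y : ℝ) :
    ∫ s in (x + 1)..(y + 1), h (s : Torus) = ∫ s in x..y, h (s : Torus) := by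
  rw [← intervalIntegral.integral_comp_add_right (fun s : ℝ => h (s : Torus)) 1]
  simp only [coe_add_one]

theorem LiftedChain.sum_cwEdges_le (hc : LiftedChain F K i u k α) (hF : Continuous F) {m n : ℕ}
    (hm : m < ℓ) (hn : n < ℓ) :
    ∑ e ∈ cwEdges ℓ m n, ∫ s in k e..k (e + 1), max (F (s : Torus)) 0 ≤
      Vplus F (pt (K (i + m))) (pt (K (i + n))) := by
  rw [← hc.coe m hm.le, ← hc.coe n hn.le, Vplus, cwEdges]
  split_ifs with h
  · rw [LiftedChain.sum_Ico k (continuous_pos hF) h, cwIntegral_coe _ (hc.mono h)]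
    linarith [hc.le m, hc.lt hn le_rfl, hc.last]
  -- The path goes through the root; its part beyond k ℓ is not counted and only adds mass.
  · have h' : n < m := by omega
    have h1 : k n + 1 < k m + 1 := by linarith [hc.lt h' hm.le]
    have h2 : k ℓ ≤ k n + 1 := by linarith [hc.le n, hc.last]
    rw [LiftedChain.sum_Ico k (continuous_pos hF) hm.le, ← coe_add_one (k n),
      cwIntegral_coe _ ((hc.mono hm.le).trans h2) h1,
      ← integral_lift_add (continuous_pos hF) (k m) (k ℓ) (k n + 1)]
    linarith [integral_pos_nonneg (F := F) h2]

theorem LiftedChain.sum_acwEdges_le (hc : LiftedChain F K i u k α) (hF : Continuous F) {m n : ℕ}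
    (hm : m < ℓ) (hn : n < ℓ) :
    ∑ e ∈ acwEdges m n, ∫ s in k e..k (e + 1), |min (F (s : Torus)) 0| ≤
      Vminus F (pt (K (i + m))) (pt (K (i + n))) := by
  rw [← hc.coe m hm.le, ← hc.coe n hn.le, Vminus, acwEdges]
  split_ifs with h
  · rw [LiftedChain.sum_Ico k (continuous_negPart hF) h, cwIntegral_coe _ (hc.mono h)]
    linarith [hc.le n, hc.lt hm le_rfl, hc.last]
  · have h' : m < n := by omega
    have h1 : k m + 1 < k n + 1 := by linarith [hc.lt h' hn.le]
    have h2 : k n ≤ k 0 + 1 := by linarith [hc.zero, hc.le_add_one hn.le]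
    have h3 : k 0 + 1 ≤ k m + 1 := by linarith [hc.mono (Nat.zero_le m)]
    rw [LiftedChain.sum_Ico k (continuous_negPart hF) (Nat.zero_le m), ← coe_add_one (k m),
      cwIntegral_coe _ (h2.trans h3) h1,
      ← integral_lift_add (continuous_negPart hF) (k n) (k 0 + 1) (k m + 1),
      integral_lift_shift (fun x => |min (F x) 0|)]
    linarith [integral_neg_nonneg (F := F) h2]

/-- The total weight of the edges of the special graph whose top is the `j`-th one. -/
theorem LiftedChain.sum_range_add_sum_Ico (hc : LiftedChain F K i u k α) (hF : Continuous F)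
    {j : ℕ} (hj : j < ℓ) :
    (∑ e ∈ Finset.range j, ∫ s in k e..k (e + 1), |min (F (s : Torus)) 0|) +
      ∑ e ∈ Finset.Ico (j + 1) ℓ, ∫ s in k e..k (e + 1), max (F (s : Torus)) 0 =
      (∫ s in (0 : ℝ)..1, max (F (s : Torus)) 0) - (S F (α j) - S F u) := by
  have hp : Function.Periodic (fun s : ℝ => max (F (s : Torus)) 0) 1 := fun s => by
    simp only [coe_add_one]
  have h0 := hp.intervalIntegral_add_eq u 0
  rw [zero_add, ← hc.last] at h0
  rw [Finset.range_eq_Ico, LiftedChain.sum_Ico k (continuous_negPart hF) (Nat.zero_le j),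
    LiftedChain.sum_Ico k (continuous_pos hF) hj, ← h0, hc.zero]
  -- Before k j, the F₋-mass is the F₊-mass minus the increment of S. In the omitted gap the F₊-mass
  -- is the climb from k j to α j. Together the loss from a full period is the height of the peak.
  have h1 := S_sub_eq hF u (k j)
  have h2 := integral_lift_add (continuous_pos hF) u (k j) (k ℓ)
  have h3 := integral_lift_add (continuous_pos hF) (k j) (α j) (k ℓ)
  have h4 := integral_lift_add (continuous_pos hF) (α j) (k (j + 1)) (k ℓ)
  have h5 := integral_pos_of_nonneg hF (hc.left j hj).le (hc.nonneg j hj)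
  have h6 := integral_pos_of_nonpos (hc.right j hj).le (hc.nonpos j hj)
  linarith

/-- V of an arrow is one of V₊ and V₋, so the combinatorial bound applies with the F₊- and F₋-masses
of the gaps; no peak is higher than the largest rise. -/
theorem LiftedChain.le_cost [NeZero ℓ] (hc : LiftedChain F K i u k α) (hF : Continuous F)
    {g : Finset (ZMod ℓ × ZMod ℓ)} (hg : g ∈ rootedTrees i) :
    (∫ s in (0 : ℝ)..1, max (F (s : Torus)) 0) - windowRise F u ≤ cost F K g := by
  obtain ⟨j, hj, hle⟩ := exists_le_sum_of_mem_rootedTrees hg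
    (fun e => ∫ s in k e..k (e + 1), max (F (s : Torus)) 0)
    (fun e => ∫ s in k e..k (e + 1), |min (F (s : Torus)) 0|)
    (fun e => integral_pos_nonneg (hc.mono e.le_succ))
    (fun e => integral_neg_nonneg (hc.mono e.le_succ))
    (fun a => setSet (V F) (K a.1) (K a.2)) (fun a => by
      have h1 := hc.sum_cwEdges_le hF (ZMod.val_lt (a.1 - i)) (ZMod.val_lt (a.2 - i))
      have h2 := hc.sum_acwEdges_le hF (ZMod.val_lt (a.1 - i)) (ZMod.val_lt (a.2 - i))
      rw [add_natCast_val_sub, add_natCast_val_sub] at h1 h2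
      rw [setSet_V, V]
      rcases min_choice (Vplus F (pt (K a.1)) (pt (K a.2))) (Vminus F (pt (K a.1)) (pt (K a.2)))
        with h | h
      · exact Or.inl (h1.trans h.ge)
      · exact Or.inr (h2.trans h.ge))
  rw [hc.sum_range_add_sum_Ico hF hj] at hle
  rw [cost]
  linarith [hc.le_windowRise hF hj]

theorem LiftedChain.Vminus_eq [NeZero ℓ] (hc : LiftedChain F K i u k α) {J m : ZMod ℓ}
    (hm : m ∈ acwStarts i J) : setSet (Vminus F) (K m) (K (m - 1)) =
      ∫ s in k ((m - i).val - 1)..k ((m - i).val - 1 + 1), |min (F (s : Torus)) 0| := by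
  have h0 := (mem_acwStarts.1 hm).1
  have hl : (m - i).val < ℓ := ZMod.val_lt _
  have h1 := hc.coe _ hl.le
  have h2 := hc.coe ((m - i).val - 1) (by omega)
  rw [Nat.cast_sub h0, ← add_sub_assoc, add_natCast_val_sub, Nat.cast_one] at h2
  rw [add_natCast_val_sub] at h1
  rw [setSet_Vminus, ← h1, ← h2, Vminus, Nat.sub_add_cancel h0,
    cwIntegral_coe _ (hc.mono (Nat.sub_le _ _))]
  linarith [hc.le ((m - i).val - 1), hc.lt hl le_rfl, hc.last]

theorem LiftedChain.Vplus_eq [NeZero ℓ] (hc : LiftedChain F K i u k α) {J m : ZMod ℓ}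
    (hm : m ∈ cwStarts i J) : setSet (Vplus F) (K m) (K (m + 1)) =
      ∫ s in k (m - i).val..k ((m - i).val + 1), max (F (s : Torus)) 0 := by
  have h0 := mem_cwStarts.1 hm
  have hl : (m - i).val < ℓ := ZMod.val_lt _
  have h1 := hc.coe _ hl.le
  have h2 := hc.coe ((m - i).val + 1) hl
  rw [Nat.cast_add, ← add_assoc, add_natCast_val_sub, Nat.cast_one] at h2
  rw [add_natCast_val_sub] at h1
  rw [setSet_Vplus, ← h1, ← h2, Vplus, cwIntegral_coe _ (hc.mono (Nat.le_succ _))]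
  -- The start is not the root, so the arrow is shorter than a full turn even when it ends at k ℓ.
  have h3 : k 0 < k (m - i).val := hc.lt (by omega) hl.le
  linarith [hc.zero, hc.le_add_one (show (m - i).val + 1 ≤ ℓ from hl)]

theorem setSet_V_le_Vplus (C D : Set Torus) : setSet (V F) C D ≤ setSet (Vplus F) C D := by
  rw [setSet_V, setSet_Vplus]
  exact min_le_left _ _

theorem setSet_V_le_Vminus (C D : Set Torus) : setSet (V F) C D ≤ setSet (Vminus F) C D := by
  rw [setSet_V, setSet_Vminus]
  exact min_le_right _ _

theorem WK_le_cost [NeZero ℓ] {g : Finset (ZMod ℓ × ZMod ℓ)} (hg : g ∈ rootedTrees i) :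
    WK F K i ≤ cost F K g :=
  Finset.inf'_le _ ((Set.Finite.mem_toFinset _).2 hg)

theorem LiftedChain.le_WK [NeZero ℓ] (hc : LiftedChain F K i u k α) (hF : Continuous F) :
    (∫ s in (0 : ℝ)..1, max (F (s : Torus)) 0) - windowRise F u ≤ WK F K i :=
  Finset.le_inf' _ _ fun _ hg => hc.le_cost hF ((Set.Finite.mem_toFinset _).1 hg)

/-- A squeeze: the cost of the special graph is at most the sum of its one-sided costs, which at a
highest peak equals the lower bound valid for all trees. All inequalities are equalities, including
the termwise ones. -/
theorem LiftedChain.optimal [NeZero ℓ] (hc : LiftedChain F K i u k α) (hF : Continuous F)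
    {J : ZMod ℓ} (hJ : S F (α (J - i).val) - S F u = windowRise F u) :
    WK F K i = (∫ s in (0 : ℝ)..1, max (F (s : Torus)) 0) - windowRise F u ∧
    WK F K i = cost F K (specialGraph i J) ∧
    (∀ m ∈ acwStarts i J, setSet (V F) (K m) (K (m - 1)) = setSet (Vminus F) (K m) (K (m - 1))) ∧
    (∀ m ∈ cwStarts i J, setSet (V F) (K m) (K (m + 1)) = setSet (Vplus F) (K m) (K (m + 1))) := by
  have h1 := hc.le_WK hF
  have h2 := WK_le_cost (F := F) (K := K) (specialGraph_mem_rootedTrees i J)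
  have h3 : cost F K (specialGraph i J) = _ :=
    sum_specialGraph i J (fun m n => setSet (V F) (K m) (K n))
  have h4 : ∀ m ∈ acwStarts i J,
      setSet (V F) (K m) (K (m - 1)) ≤ setSet (Vminus F) (K m) (K (m - 1)) :=
    fun m _ => setSet_V_le_Vminus _ _
  have h5 : ∀ m ∈ cwStarts i J,
      setSet (V F) (K m) (K (m + 1)) ≤ setSet (Vplus F) (K m) (K (m + 1)) :=
    fun m _ => setSet_V_le_Vplus _ _
  have h6 := Finset.sum_le_sum h4
  have h7 := Finset.sum_le_sum h5
  have h8 := hc.sum_range_add_sum_Ico hF (ZMod.val_lt (J - i))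
  rw [hJ, ← sum_acwStarts i J fun e => ∫ s in k e..k (e + 1), |min (F (s : Torus)) 0|,
    ← sum_cwStarts i J fun e => ∫ s in k e..k (e + 1), max (F (s : Torus)) 0,
    ← Finset.sum_congr rfl fun m hm => hc.Vminus_eq hm,
    ← Finset.sum_congr rfl fun m hm => hc.Vplus_eq hm] at h8
  refine ⟨by linarith, by linarith, ?_, ?_⟩
  · exact (Finset.sum_eq_sum_iff_of_le h4).1 (by linarith)
  · exact (Finset.sum_eq_sum_iff_of_le h5).1 (by linarith)

/-- The right-hand side does not involve u', which shows that the identity holds for all lifts of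
points of the component or for none. -/
theorem LiftedChain.realizes_iff [NeZero ℓ] (hc : LiftedChain F K i u k α) (hF : Continuous F)
    (hK : IsLabelling F K) (J : ZMod ℓ) {u' : ℝ} (hu' : (u' : Torus) ∈ K i) :
    Realizes F K i J u' ↔ S F (α (J - i).val) - S F u = windowRise F u := by
  have hl : (J - i).val < ℓ := ZMod.val_lt _
  have h0 := hc.coe 0 (Nat.zero_le _)
  rw [Nat.cast_zero, add_zero, hc.zero] at h0
  have h1 := hc.coe_top _ hl
  rw [add_natCast_val_sub] at h1
  have h2 := hc.top_mem hl
  rw [Realizes, ← (hK.isStable i).windowRise_eq hF (h0 ▸ hK.pt_mem i : (u : Torus) ∈ K i) hu', ← h0,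
    ← h1, deltaS, cwIntegral_coe _ h2.1.le h2.2, S_sub_S hF]

/-- The height of a stable component is the mass of the positive part of `F`, minus the largest rise
of the potential from that component. -/
theorem IsLabelling.WK_eq [NeZero ℓ] (hF : Continuous F)
    (hfin : {C : Set Torus | IsZeroComponent F C}.Finite) (hK : IsLabelling F K)
    (hu : (u : Torus) ∈ K i) :
    WK F K i = (∫ s in (0 : ℝ)..1, max (F (s : Torus)) 0) - windowRise F u := by
  obtain ⟨u₀, -, hu₀⟩ := exists_lift 0 (pt (K i))
  obtain ⟨k, α, hc⟩ := hK.exists_liftedChain hF hfin hu₀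
  obtain ⟨n, hn, hJ⟩ := hc.exists_eq_windowRise hF
  rw [← val_add_natCast_sub i hn] at hJ
  rw [(hc.optimal hF hJ).1,
    (hK.isStable i).windowRise_eq hF (hu₀ ▸ hK.pt_mem i : (u₀ : Torus) ∈ K i) hu]

end Chain

/-! ### The height of points outside the stable components. -/

section Points

variable {F : Torus → ℝ} {ℓ : ℕ} {K : ZMod ℓ → Set Torus} {i : ZMod ℓ} {u v w c d : ℝ}

theorem setPoint_of_notMem (f : Torus → Torus → ℝ) {C : Set Torus} {x : Torus} (hx : x ∉ C) :
    setPoint f C x = f (pt C) x := if_neg hx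

theorem W_le [NeZero ℓ] (x : Torus) (i : ZMod ℓ) :
    W F K x ≤ WK F K i + setPoint (V F) (K i) x :=
  Finset.inf'_le (fun i => WK F K i + setPoint (V F) (K i) x) (Finset.mem_univ i)

theorem IsLabelling.le_W [NeZero ℓ] (hF : Continuous F)
    (hfin : {C : Set Torus | IsZeroComponent F C}.Finite) (hK : IsLabelling F K)
    (hv : ∀ r, (v : Torus) ∉ K r) :
    (∫ s in (0 : ℝ)..1, max (F (s : Torus)) 0) - windowRise F v ≤ W F K (v : Torus) := by
  refine Finset.le_inf' _ _ fun r _ => ?_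
  obtain ⟨u, -, hu⟩ := exists_lift 0 (pt (K r))
  rw [hK.WK_eq hF hfin (hu ▸ hK.pt_mem r : (u : Torus) ∈ K r), setPoint_of_notMem _ (hv r), ← hu]
  linarith [windowRise_le_V hF u v]

/-- A stable component from which a one-sided path realizes the difference of the largest rises
is optimal. -/
theorem IsLabelling.W_eq [NeZero ℓ] (hF : Continuous F)
    (hfin : {C : Set Torus | IsZeroComponent F C}.Finite) (hK : IsLabelling F K)
    (hv : ∀ r, (v : Torus) ∉ K r) (hu : (u : Torus) ∈ K i) {f : Torus → Torus → ℝ}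
    (hf : ∀ x y, V F x y ≤ f x y) (h : f (pt (K i)) v ≤ windowRise F u - windowRise F v) :
    W F K v = WK F K i + setPoint (V F) (K i) v ∧
      setPoint (V F) (K i) v = setPoint f (K i) v := by
  have h1 := hK.le_W hF hfin hv
  have h2 := W_le (F := F) (K := K) (v : Torus) i
  have h3 := hK.WK_eq hF hfin hu
  have h4 := hf (pt (K i)) v
  rw [setPoint_of_notMem _ (hv i)] at h2 ⊢
  rw [setPoint_of_notMem _ (hv i)]
  constructor <;> linarith

theorem leLe_left_iff (huc : u < c) (hcd : c ≤ d) (hdu : d < u + 1) (hv : v ∈ Ioo u (u + 1)) :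
    LeLe {(u : Torus)} (v : Torus) ((fun s : ℝ => (s : Torus)) '' Icc c d) ↔ v ≤ d := by
  constructor
  · rintro ⟨_, rfl, _, ⟨β, hβ, rfl⟩, h⟩
    rw [cwArc_coe (by linarith [hβ.1]) (by linarith [hβ.2])] at h
    obtain ⟨r, hr, hrv⟩ := h
    have := eq_of_coe_eq hrv (by linarith [hv.1, hr.2, hβ.2]) (by linarith [hv.2, hr.1])
    linarith [hr.2, hβ.2]
  · intro hvd
    refine ⟨_, rfl, _, ⟨d, ⟨hcd, le_rfl⟩, rfl⟩, ?_⟩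
    rw [cwArc_coe (by linarith) hdu]
    exact ⟨v, ⟨hv.1.le, hvd⟩, rfl⟩

theorem leLe_right_iff (hwc : w < c + 1) (hcd : c ≤ d) (hdw : d < w) (hv : v ∈ Ioo (w - 1) w) :
    LeLe ((fun s : ℝ => (s : Torus)) '' Icc c d) (v : Torus) {(w : Torus)} ↔ c ≤ v := by
  constructor
  · rintro ⟨_, ⟨β, hβ, rfl⟩, _, rfl, h⟩
    rw [cwArc_coe (by linarith [hβ.2]) (by linarith [hβ.1])] at h
    obtain ⟨r, hr, hrv⟩ := h
    have := eq_of_coe_eq hrv (by linarith [hv.1, hr.2]) (by linarith [hv.2, hr.1, hβ.1])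
    linarith [hr.1, hβ.1]
  · intro hcv
    refine ⟨_, ⟨c, ⟨le_rfl, hcd⟩, rfl⟩, _, rfl, ?_⟩
    rw [cwArc_coe (by linarith) hwc]
    exact ⟨v, ⟨hcv, hv.2.le⟩, rfl⟩

/-- The part of the window lost by moving from u to v is one where S increases towards v. -/
theorem windowMax_le_of_nonneg (hF : Continuous F) (huv : u ≤ v)
    (hpos : ∀ s ∈ Icc u v, 0 ≤ F (s : Torus)) : windowMax F u ≤ windowMax F v := by
  refine windowMax_le fun y hy => ?_
  rcases le_total v y with h | h
  · exact S_le_windowMax hF ⟨h, by linarith [hy.2]⟩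
  · exact (S_mono_of_nonneg hF h fun s hs => hpos s ⟨hy.1.trans hs.1, hs.2⟩).trans
      (S_le_windowMax hF ⟨le_rfl, by linarith⟩)

/-- The part of the window of w beyond v + 1 is a translate of a piece of [v, w], where S decreases;
there it stays below S(v + 1). -/
theorem windowMax_le_of_nonpos (hF : Continuous F) (hvw : v ≤ w)
    (hneg : ∀ s ∈ Icc v w, F (s : Torus) ≤ 0) : windowMax F w ≤ windowMax F v := by
  refine windowMax_le fun y hy => ?_
  rcases le_total y (v + 1) with h | h
  · exact S_le_windowMax hF ⟨hvw.trans hy.1, h⟩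
  · have h1 := S_add_one hF v
    have h2 := S_add_one hF (y - 1)
    rw [sub_add_cancel] at h2
    have h3 := S_anti_of_nonpos hF (x := v) (y := y - 1) (by linarith)
      fun s hs => hneg s ⟨hs.1, by linarith [hs.2, hy.2]⟩
    linarith [S_le_windowMax hF (u := v) (y := v + 1) ⟨by linarith, le_rfl⟩]

theorem integral_pos_le_of_windowMax_eq (hF : Continuous F) (huv : u ≤ v)
    (hpos : ∀ s ∈ Icc u v, 0 ≤ F (s : Torus)) (hM : windowMax F u = windowMax F v) :
    ∫ s in u..v, max (F (s : Torus)) 0 ≤ windowRise F u - windowRise F v := by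
  rw [integral_pos_of_nonneg hF huv hpos, windowRise_eq hF, windowRise_eq hF, hM]
  linarith

theorem integral_neg_le_of_windowMax_eq (hF : Continuous F) (hvw : v ≤ w)
    (hneg : ∀ s ∈ Icc v w, F (s : Torus) ≤ 0) (hM : windowMax F w = windowMax F v) :
    ∫ s in v..w, |min (F (s : Torus)) 0| ≤ windowRise F w - windowRise F v := by
  rw [integral_neg_of_nonpos hF hvw hneg, windowRise_eq hF, windowRise_eq hF, hM]
  linarith

/-- The maximiser for v must lie in (u + 1, v + 1], so the maximum is at most S(v + 1). The window
of w contains the peak d + 1, and the difference of rises is at least S(d) − S(w), the F₋-cost from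
w back to v. -/
theorem integral_neg_le_of_windowMax_lt (hF : Continuous F) (huv : u ≤ v) (hvd : v ≤ d) (hdw : d ≤ w)
    (hwu : w ≤ u + 1) (hpos : ∀ s ∈ Icc u d, 0 ≤ F (s : Torus))
    (hneg : ∀ s ∈ Icc d w, F (s : Torus) ≤ 0) (hM : windowMax F u < windowMax F v) :
    ∫ s in v..w, |min (F (s : Torus)) 0| ≤ windowRise F w - windowRise F v := by
  rw [← integral_lift_add (continuous_negPart hF) v d w,
    integral_neg_of_nonneg hvd fun s hs => hpos s ⟨huv.trans hs.1, hs.2⟩,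
    integral_neg_of_nonpos hF hdw hneg, windowRise_eq hF, windowRise_eq hF]
  obtain ⟨y, hy, hyM⟩ := exists_S_eq_windowMax hF v
  have h1 : u + 1 < y := by
    by_contra! h
    linarith [S_le_windowMax hF (u := u) (y := y) ⟨huv.trans hy.1, h⟩]
  have h2 := S_add_one hF (y - 1)
  rw [sub_add_cancel] at h2
  have h3 := S_mono_of_nonneg hF (x := y - 1) (y := v) (by linarith [hy.2])
    fun s hs => hpos s ⟨by linarith [hs.1], hs.2.trans hvd⟩
  have h4 := S_le_windowMax hF (u := w) (y := d + 1) ⟨by linarith, by linarith⟩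
  have h5 := S_add_one hF d
  linarith

/-- The maximiser for v must lie before w, where S decreases, so the maximum is at most S(v). The
window of u contains the peak c, and the difference of rises is at least S(c) − S(u), the F₊-cost
from u to v. -/
theorem integral_pos_le_of_windowMax_lt (hF : Continuous F) (huc : u ≤ c) (hcv : c ≤ v) (hvw : v ≤ w)
    (hwu : w ≤ u + 1) (hpos : ∀ s ∈ Icc u c, 0 ≤ F (s : Torus))
    (hneg : ∀ s ∈ Icc c w, F (s : Torus) ≤ 0) (hM : windowMax F w < windowMax F v) :
    ∫ s in u..v, max (F (s : Torus)) 0 ≤ windowRise F u - windowRise F v := by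
  rw [← integral_lift_add (continuous_pos hF) u c v,
    integral_pos_of_nonpos hcv fun s hs => hneg s ⟨hs.1, hs.2.trans hvw⟩,
    integral_pos_of_nonneg hF huc hpos, windowRise_eq hF, windowRise_eq hF]
  obtain ⟨y, hy, hyM⟩ := exists_S_eq_windowMax hF v
  have h1 : y < w := by
    by_contra! h
    linarith [S_le_windowMax hF (u := w) (y := y) ⟨h, by linarith [hy.2]⟩]
  have h2 := S_anti_of_nonpos hF (x := v) (y := y) hy.1
    fun s hs => hneg s ⟨hcv.trans hs.1, hs.2.trans h1.le⟩
  have h3 := S_le_windowMax hF (u := u) (y := c) ⟨huc, by linarith⟩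
  linarith

theorem IsLabelling.exists_between [NeZero ℓ] (hK : IsLabelling F K) {x : Torus}
    (hx : ∀ r, x ∉ K r) (hF : Continuous F)
    (hfin : {C : Set Torus | IsZeroComponent F C}.Finite) :
    ∃ i : ZMod ℓ, Between (K i) x (K (i + 1)) := by
  obtain ⟨u, -, hu⟩ := exists_lift 0 (pt (K 0))
  obtain ⟨k, α, hc⟩ := hK.exists_liftedChain hF hfin hu
  obtain ⟨v, hv, rfl⟩ := exists_lift u x
  obtain ⟨n, hn, h1, h2⟩ := hc.exists_mem (Ioc_subset_Icc_self hv) (Nat.pos_of_ne_zero (NeZero.ne ℓ))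
  have e1 : (k n : Torus) ∈ K (0 + n) := hc.coe n hn.le ▸ hK.pt_mem _
  have e2 : (k (n + 1) : Torus) ∈ K (0 + n + 1) := by
    have := hc.coe (n + 1) hn
    rw [Nat.cast_add, ← add_assoc, Nat.cast_one] at this
    exact this ▸ hK.pt_mem _
  have g1 : k n < v := lt_of_le_of_ne h1 fun h => hx _ (h ▸ e1)
  have g2 : v < k (n + 1) := lt_of_le_of_ne h2 fun h => hx _ (h ▸ e2)
  have g3 : k (n + 1) ≤ k n + 1 := by linarith [hc.le n, hc.le_add_one (show n + 1 ≤ ℓ from hn)]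
  refine ⟨0 + n, (hK.between_iff e1 e2 ⟨g1.trans g2, g3⟩ (fun hℓ => ?_) ⟨g1, by linarith⟩ (hx _)
    (hx _)).2 g2⟩
  subst hℓ
  obtain rfl : n = 0 := by omega
  rw [hc.zero, hc.last, coe_add_one]

theorem existsUnique_fin_four {p q r s : Prop}
    (h : (p ∧ ¬q ∧ ¬r ∧ ¬s) ∨ (¬p ∧ q ∧ ¬r ∧ ¬s) ∨ (¬p ∧ ¬q ∧ r ∧ ¬s) ∨ (¬p ∧ ¬q ∧ ¬r ∧ s)) :
    ∃! k : Fin 4, ![p, q, r, s] k := by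
  rcases h with h | h | h | h
  · exact ⟨0, h.1, fun k hk => by fin_cases k <;> simp_all⟩
  · exact ⟨1, h.2.1, fun k hk => by fin_cases k <;> simp_all⟩
  · exact ⟨2, h.2.2.1, fun k hk => by fin_cases k <;> simp_all⟩
  · exact ⟨3, h.2.2.2, fun k hk => by fin_cases k <;> simp_all⟩

end Points

end FW

/-! ### Assembly of the two parts. -/

theorem mainTheorem3 (F : FW.Torus → ℝ) (hF : Continuous F)
    (hfin : {C : Set FW.Torus | FW.IsZeroComponent F C}.Finite)
    (ℓ : ℕ) [NeZero ℓ] (K : ZMod ℓ → Set FW.Torus) (hK : FW.IsLabelling F K) :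
    -- part (i)
    (2 ≤ ℓ → ∀ i : ZMod ℓ,
      (∃ J : ZMod ℓ, ∀ u : ℝ, (u : FW.Torus) ∈ K i → FW.Realizes F K i J u) ∧
      ∀ J : ZMod ℓ, (∃ u : ℝ, (u : FW.Torus) ∈ K i ∧ FW.Realizes F K i J u) →
        (∀ u : ℝ, (u : FW.Torus) ∈ K i → FW.Realizes F K i J u) ∧
        FW.specialGraph i J ∈ FW.rootedTrees i ∧
        FW.WK F K i =
          ∑ p ∈ FW.specialGraph i J, FW.setSet (FW.V F) (K p.1) (K p.2) ∧
        (∀ m ∈ FW.acwStarts i J,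
          FW.setSet (FW.V F) (K m) (K (m - 1)) = FW.setSet (FW.Vminus F) (K m) (K (m - 1))) ∧
        (∀ m ∈ FW.cwStarts i J,
          FW.setSet (FW.V F) (K m) (K (m + 1)) = FW.setSet (FW.Vplus F) (K m) (K (m + 1)))) ∧
    -- part (ii)
    (∀ x : FW.Torus, (∀ r, x ∉ K r) →
      (∃ i : ZMod ℓ, FW.Between (K i) x (K (i + 1))) ∧
      ∀ i : ZMod ℓ, FW.Between (K i) x (K (i + 1)) →
      ∀ u v w : ℝ, (u : FW.Torus) ∈ K i → (w : FW.Torus) ∈ K (i + 1) →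
        (ℓ = 1 → (u : FW.Torus) = (w : FW.Torus)) →
        v ∈ Set.Ioc u (u + 1) → w ∈ Set.Ioc u (u + 1) → (v : FW.Torus) = x →
        (x ∉ FW.unstableBetween F K i →
          ∃! k : Fin 4,
            ![FW.Case1 F (FW.unstableBetween F K i) u v, FW.Case2 F (FW.unstableBetween F K i) u v,
              FW.Case3 F (FW.unstableBetween F K i) v w,
              FW.Case4 F (FW.unstableBetween F K i) v w] k) ∧
        (x ∈ FW.unstableBetween F K i →
          Xor (FW.Case1 F (FW.unstableBetween F K i) u v)
            (FW.Case2 F (FW.unstableBetween F K i) u v) ∧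
          Xor (FW.Case3 F (FW.unstableBetween F K i) v w)
            (FW.Case4 F (FW.unstableBetween F K i) v w)) ∧
        (FW.Case1 F (FW.unstableBetween F K i) u v ∨ FW.Case4 F (FW.unstableBetween F K i) v w →
          FW.W F K x = FW.WK F K i + FW.setPoint (FW.V F) (K i) x ∧
          FW.setPoint (FW.V F) (K i) x = FW.setPoint (FW.Vplus F) (K i) x) ∧
        (FW.Case2 F (FW.unstableBetween F K i) u v ∨ FW.Case3 F (FW.unstableBetween F K i) v w →
          FW.W F K x = FW.WK F K (i + 1) + FW.setPoint (FW.V F) (K (i + 1)) x ∧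
          FW.setPoint (FW.V F) (K (i + 1)) x = FW.setPoint (FW.Vminus F) (K (i + 1)) x)) := by
  refine ⟨fun _ i => ?_, fun x hx => ⟨hK.exists_between hx hF hfin, ?_⟩⟩
  · obtain ⟨u₀, -, hu₀⟩ := FW.exists_lift 0 (FW.pt (K i))
    obtain ⟨k, α, hc⟩ := hK.exists_liftedChain hF hfin hu₀
    constructor
    · obtain ⟨n, hn, hJ⟩ := hc.exists_eq_windowRise hF
      rw [← FW.val_add_natCast_sub i hn] at hJ
      exact ⟨i + n, fun u hu => (hc.realizes_iff hF hK _ hu).2 hJ⟩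
    · rintro J ⟨u, hu, hJu⟩
      have hJ := (hc.realizes_iff hF hK J hu).1 hJu
      obtain ⟨-, h1, h2, h3⟩ := hc.optimal hF hJ
      exact ⟨fun u' hu' => (hc.realizes_iff hF hK J hu').2 hJ, FW.specialGraph_mem_rootedTrees i J,
        h1, h2, h3⟩
  · intro i hbet u v w hu hw h1 hv hwu hvx
    subst hvx
    obtain ⟨c, d, huc, hcd, hdw, hA, hpos, hneg⟩ := hK.exists_gap hF hfin hu hw hwu h1
    have hvw : v < w := (hK.between_iff hu hw hwu h1 hv (hx _) (hx _)).1 hbet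
    have hwu2 : w ≤ u + 1 := hwu.2
    have huv : u < v := hv.1
    have hle1 := FW.leLe_left_iff (v := v) huc hcd (by linarith) ⟨huv, by linarith⟩
    have hle2 := FW.leLe_right_iff (v := v) (by linarith) hcd hdw ⟨by linarith, hvw⟩
    have hne1 : (v : FW.Torus) ≠ (u : FW.Torus) := fun h => hx i (h ▸ hu)
    have hne2 : (v : FW.Torus) ≠ (w : FW.Torus) := fun h => hx (i + 1) (h ▸ hw)
    have hmem : (v : FW.Torus) ∈ FW.unstableBetween F K i ↔ c ≤ v ∧ v ≤ d := by
      rw [hA]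
      constructor
      · rintro ⟨r, hr, hrv⟩
        have := FW.eq_of_coe_eq hrv (by linarith [hr.2]) (by linarith [hr.1])
        exact this ▸ hr
      · exact fun h => ⟨v, h, rfl⟩
    rw [← hA] at hle1 hle2
    have hc1 : FW.Case1 F (FW.unstableBetween F K i) u v ↔
        v ≤ d ∧ FW.windowMax F u = FW.windowMax F v :=
      and_congr_left fun _ => ((and_iff_right hne1).trans hle1)
    have hc2 : FW.Case2 F (FW.unstableBetween F K i) u v ↔
        v ≤ d ∧ FW.windowMax F u < FW.windowMax F v :=
      and_congr_left fun _ => ((and_iff_right hne1).trans hle1)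
    have hc3 : FW.Case3 F (FW.unstableBetween F K i) v w ↔
        c ≤ v ∧ FW.windowMax F w = FW.windowMax F v :=
      and_congr_left fun _ => ((and_iff_right hne2).trans hle2)
    have hc4 : FW.Case4 F (FW.unstableBetween F K i) v w ↔
        c ≤ v ∧ FW.windowMax F w < FW.windowMax F v :=
      and_congr_left fun _ => ((and_iff_right hne2).trans hle2)
    have hM1 : v ≤ d → FW.windowMax F u ≤ FW.windowMax F v := fun h =>
      FW.windowMax_le_of_nonneg hF huv.le fun s hs => hpos s ⟨hs.1, hs.2.trans h⟩
    have hM2 : c ≤ v → FW.windowMax F w ≤ FW.windowMax F v := fun h =>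
      FW.windowMax_le_of_nonpos hF hvw.le fun s hs => hneg s ⟨h.trans hs.1, hs.2⟩
    rw [hc1, hc2, hc3, hc4, hmem]
    refine ⟨fun hnA => ?_, fun hA' => ?_, fun h => ?_, fun h => ?_⟩
    -- Off the unstable component only one side of the peak is available; monotonicity of the window
    -- maximum there leaves just equality or strict inequality.
    · rcases lt_or_ge d v with hdv | hvd
      · have hcv : c ≤ v := hcd.trans hdv.le
        rcases (hM2 hcv).eq_or_lt with hM | hM
        · exact FW.existsUnique_fin_four (Or.inr (Or.inr (Or.inl
            ⟨fun h => hdv.not_ge h.1, fun h => hdv.not_ge h.1, ⟨hcv, hM⟩, fun h => h.2.ne hM⟩)))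
        · exact FW.existsUnique_fin_four (Or.inr (Or.inr (Or.inr
            ⟨fun h => hdv.not_ge h.1, fun h => hdv.not_ge h.1, fun h => hM.ne h.2, ⟨hcv, hM⟩⟩)))
      · have hcv : ¬ c ≤ v := fun h => hnA ⟨h, hvd⟩
        rcases (hM1 hvd).eq_or_lt with hM | hM
        · exact FW.existsUnique_fin_four (Or.inl
            ⟨⟨hvd, hM⟩, fun h => h.2.ne hM, fun h => hcv h.1, fun h => hcv h.1⟩)
        · exact FW.existsUnique_fin_four (Or.inr (Or.inl
            ⟨fun h => hM.ne h.2, ⟨hvd, hM⟩, fun h => hcv h.1, fun h => hcv h.1⟩))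
    · constructor
      · rcases (hM1 hA'.2).eq_or_lt with hM | hM
        · exact Or.inl ⟨⟨hA'.2, hM⟩, fun h => h.2.ne hM⟩
        · exact Or.inr ⟨⟨hA'.2, hM⟩, fun h => hM.ne h.2⟩
      · rcases (hM2 hA'.1).eq_or_lt with hM | hM
        · exact Or.inl ⟨⟨hA'.1, hM⟩, fun h => h.2.ne hM⟩
        · exact Or.inr ⟨⟨hA'.1, hM⟩, fun h => hM.ne h.2⟩
    -- Before the peak, equal maxima give the clockwise bound from K i; after it, the path crosses
    -- the peak and the strict inequality is needed. The anticlockwise bound from K (i + 1) below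
    -- mirrors this.
    · refine hK.W_eq hF hfin hx hu (fun _ _ => min_le_left _ _) ?_
      rw [FW.Vplus, (hK.isStable i).cwIntegral_pt_left (FW.continuous_pos hF)
        (fun x hx => by simp [hx]) hu hv (hx i)]
      rcases h with ⟨hvd, hM⟩ | ⟨hcv, hM⟩
      · exact FW.integral_pos_le_of_windowMax_eq hF huv.le (fun s hs => hpos s ⟨hs.1, hs.2.trans hvd⟩) hM
      · exact FW.integral_pos_le_of_windowMax_lt hF huc.le hcv hvw.le hwu2
          (fun s hs => hpos s ⟨hs.1, hs.2.trans hcd⟩) hneg hM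
    · refine hK.W_eq hF hfin hx hw (fun _ _ => min_le_right _ _) ?_
      rw [FW.Vminus, (hK.isStable (i + 1)).cwIntegral_pt_right (FW.continuous_negPart hF)
        (fun x hx => by simp [hx]) hw hvw (by linarith) (hx _)]
      rcases h with ⟨hvd, hM⟩ | ⟨hcv, hM⟩
      · exact FW.integral_neg_le_of_windowMax_lt hF huv.le hvd hdw.le hwu2 hpos
          (fun s hs => hneg s ⟨hcd.trans hs.1, hs.2⟩) hM
      · exact FW.integral_neg_le_of_windowMax_eq hF hvw.le (fun s hs => hneg s ⟨hcv.trans hs.1, hs.2⟩) hM
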